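/- Let $p > 3$ be a prime and let $w \in \{1,\dots,p-1\}$ represent a generator of the multiplicative group $\mathbb{F}_p^*$. Write $[h,g] = h^{-1}g^{-1}hg$. For a group $X$ let $\gamma_0(X) = X$ and $\gamma_{i+1}(X) = \langle [h,g]k^p \mid h,k \in \gamma_i(X),\ g \in X\rangle$; the $p$-class of a finite $p$-group $X$ is the least $c$ with $\gamma_c(X) = 1$. A finite $p$-group $H$ is an immediate descendant of a finite $p$-group $G$ of $p$-class $c$ if $H$ and $G$ have the same minimal number of generators, $H/\gamma_c(H) \cong G$, and $H$ has $p$-class $c+1$. In the presentations below all relations $x_i^p = 1$ and $[x_j,x_i] = 1$ ($i<j$) are understood for those powers and commutators of the generators that are not mentioned. Let $G = \langle a_1,a_2,a_3,a_4 \mid [a_2,a_1] = a_3,\ a_1^p = a_4\rangle$, a group of order $p^4$. Then the following nine groups have order $p^5$, are immediate descendants of $G$ and are pairwise non-isomorphic, and every immediate descendant of $G$ of order $p^5$ is isomorphic to one of them. Each group is generated by $g_1,\dots,g_5$ with the relations $[g_2,g_1] = g_3$, $g_1^p = g_4$ and, in addition, - $G_1$: $g_4^p = g_5$; - $G_2$: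 $[g_3,g_1] = g_5$; - $G_3$: $[g_3,g_1] = g_5$, $g_2^p = g_5$; - $G_4$: $[g_3,g_1] = g_5^w$, $g_2^p = g_5$; - $G_5$: $[g_3,g_1] = g_5$, $g_4^p = g_5$; - $G_6$: $[g_3,g_1] = g_5$, $[g_3,g_2] = g_5$; - $G_7$: $[g_3,g_1] = g_5$, $[g_3,g_2] = g_5$, $g_2^p = g_5$; - $G_8$: $[g_3,g_1] = g_5$, $[g_3,g_2] = g_5$, $g_4^p = g_5$; - $G_9$: $[g_3,g_1] = g_5^w$, $[g_3,g_2] = g_5^w$, $g_4^p = g_5$. -/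

import Mathlib

/-! ### Lower exponent-p central series, p-class, descendants -/

/-- The commutator `[h, g] = h⁻¹ g⁻¹ h g` (Mathlib's `⁅h, g⁆` is `h g h⁻¹ g⁻¹`). -/
def pgComm {G : Type*} [Group G] (h g : G) : G := h⁻¹ * g⁻¹ * h * g

/-- The lower exponent-`p` central series: `γ₀(G) = G` and
`γᵢ₊₁(G) = ⟨ [h, g] k ^ p | h, k ∈ γᵢ(G), g ∈ G ⟩`. -/
def lowerPSeries (p : ℕ) (G : Type*) [Group G] : ℕ → Subgroup G
  | 0 => ⊤
  | i + 1 => Subgroup.closure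
      {x | ∃ h ∈ lowerPSeries p G i, ∃ k ∈ lowerPSeries p G i, ∃ g : G, x = pgComm h g * k ^ p}

instance lowerPSeries_normal (p : ℕ) (G : Type*) [Group G] (i : ℕ) :
    (lowerPSeries p G i).Normal := by
  induction i with
  | zero => exact (inferInstance : (⊤ : Subgroup G).Normal)
  | succ i ih =>
    have hset : ∀ x ∈ {x : G | ∃ h ∈ lowerPSeries p G i, ∃ k ∈ lowerPSeries p G i, ∃ g : G,
        x = pgComm h g * k ^ p}, ∀ c : G, c * x * c⁻¹ ∈ {x : G | ∃ h ∈ lowerPSeries p G i,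
          ∃ k ∈ lowerPSeries p G i, ∃ g : G, x = pgComm h g * k ^ p} := by
      rintro x ⟨h, hh, k, hk, g, rfl⟩ c
      refine ⟨c * h * c⁻¹, ih.conj_mem h hh c, c * k * c⁻¹, ih.conj_mem k hk c, c * g * c⁻¹, ?_⟩
      rw [conj_pow]
      simp only [pgComm]
      group
    refine ⟨fun n hn c => ?_⟩
    simp only [lowerPSeries] at hn ⊢
    induction hn using Subgroup.closure_induction with
    | mem x hx => exact Subgroup.subset_closure (hset x hx c)
    | one => simp
    | mul x y _ _ hx hy =>
      have e : c * (x * y) * c⁻¹ = (c * x * c⁻¹) * (c * y * c⁻¹) := by group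
      rw [e]
      exact mul_mem hx hy
    | inv x _ hx =>
      have e : c * x⁻¹ * c⁻¹ = (c * x * c⁻¹)⁻¹ := by group
      rw [e]
      exact inv_mem hx

/-- `G` has `p`-class `c`: `c` is the least index with `γ_c(G) = 1`. -/
def HasPClass (p : ℕ) (G : Type*) [Group G] (c : ℕ) : Prop :=
  IsLeast {i : ℕ | lowerPSeries p G i = ⊥} c

/-- `H` is an immediate descendant of `G`: both are finite `p`-groups with the same minimal number
of generators, and if `c` is the `p`-class of `G`, then `H / γ_c(H) ≅ G` and `H` has `p`-class
`c + 1`. -/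
structure IsImmediateDescendant (p : ℕ) (H G : Type*) [Group H] [Group G] : Prop where
  finite_base : Finite G
  isPGroup_base : IsPGroup p G
  finite : Finite H
  isPGroup : IsPGroup p H
  rank_eq : Group.rank H = Group.rank G
  quotient_and_class : ∃ c : ℕ, HasPClass p G c ∧
    Nonempty (H ⧸ lowerPSeries p H c ≃* G) ∧ HasPClass p H (c + 1)

/-! ### Power-commutator presentations -/

/-- Relators of the power-commutator presentation with the relations `gᵢ ^ p = pow i` for all `i`
and `[gⱼ, gᵢ] = com j i` for all `i < j`. -/
def pcRelators (p n : ℕ) (pow : Fin n → FreeGroup (Fin n))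
    (com : Fin n → Fin n → FreeGroup (Fin n)) : Set (FreeGroup (Fin n)) :=
  {r | ∃ i, r = FreeGroup.of i ^ p * (pow i)⁻¹} ∪
  {r | ∃ i j, i < j ∧ r = pgComm (FreeGroup.of j) (FreeGroup.of i) * (com j i)⁻¹}

/-- The group `⟨a₁, a₂, a₃, a₄ | [a₂, a₁] = a₃, a₁ ^ p = a₄⟩`, where the `p`-th powers of the other
generators and the other commutators `[aⱼ, aᵢ]`, `i < j`, are trivial.
The generator `aᵢ` has index `i - 1`. -/
abbrev BaseGroup (p : ℕ) : Type :=
  PresentedGroup (pcRelators p 4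
    (fun i => if i = 0 then FreeGroup.of 3 else 1)
    (fun j i => if j = 1 ∧ i = 0 then FreeGroup.of 2 else 1))

/-- The group on `g₁, …, g₅` with the relations `[g₂, g₁] = g₃`, `g₁ ^ p = g₄`,
`[g₃, g₁] = g₅ ^ e₀`, `[g₃, g₂] = g₅ ^ e₁`, `g₄ ^ p = g₅ ^ e₂`, `g₂ ^ p = g₅ ^ e₃`, where the
`p`-th powers of `g₃`, `g₅` and the other commutators `[gⱼ, gᵢ]`, `i < j`, are trivial.
The generator `gᵢ` has index `i - 1`. -/
abbrev ExtGroup (p : ℕ) (e : Fin 4 → ℕ) : Type :=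
  PresentedGroup (pcRelators p 5
    (fun i =>
      if i = 0 then FreeGroup.of 3
      else if i = 1 then FreeGroup.of 4 ^ e 3
      else if i = 3 then FreeGroup.of 4 ^ e 2
      else 1)
    (fun j i =>
      if j = 1 ∧ i = 0 then FreeGroup.of 2
      else if j = 2 ∧ i = 0 then FreeGroup.of 4 ^ e 0
      else if j = 2 ∧ i = 1 then FreeGroup.of 4 ^ e 1
      else 1))

/-- The exponents of `g₅` in `[g₃, g₁]`, `[g₃, g₂]`, `g₄ ^ p`, `g₂ ^ p` (in this order) for the
nine groups `G₁, …, G₉` of the list (`Gᵢ` has index `i - 1`). -/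
def listExponents (w : ℕ) : Fin 9 → Fin 4 → ℕ :=
  ![![0, 0, 1, 0],
    ![1, 0, 0, 0],
    ![1, 0, 0, 1],
    ![w, 0, 0, 1],
    ![1, 0, 1, 0],
    ![1, 1, 0, 0],
    ![1, 1, 0, 1],
    ![1, 1, 1, 0],
    ![w, w, 1, 0]]

/-- The groups `G₁, …, G₉` of the list; the exponent `w` is the representative of `w` in
`{0, …, p - 1}`. -/
abbrev ListGroup (p : ℕ) (w : (ZMod p)ˣ) (i : Fin 9) : Type :=
  ExtGroup p (listExponents (w : ZMod p).val i)

/-! Write `E(a,b,c,d)` for the extension with `[z,x] = n^a`, `[z,y] = n^b`, `u^p = n^c`, `y^p =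
n^d`. The classification reduces to counting orbits of parameters under changes of generators.

Every `E(a,b,c,d)` has order `p^5`. Collecting words gives at most `p^5` elements
(`ExtRel.card_le`). For the lower bound, a group in exponential coordinates, `Model`, satisfies the
relations and has at least `p^5` elements. All later computations take place in `Model`, where
powers and commutators have closed formulas; `p > 3` makes the denominator 12 of the
Baker-Campbell-Hausdorff formula invertible.

If `(a,b,c) ≠ 0`, then `γ₂ = ⟨n⟩` has order `p`, `γ₃ = 1` and the quotient by `γ₂` is the base
group, so `E(a,b,c,d)` is an immediate descendant. Conversely, in a descendant `H` of order `p^5`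
the subgroup `γ₂(H)` is central of order `p`, and lifts of the two generators of the base group
satisfy the relations of some `E(a,b,c,d)` (`exists_extRel_of_central`); `a = b = c = 0` is
impossible, since then `γ₂ = 1`.

An isomorphism sends the generators to `X = x^i y^j ⋯`, `Y = x^(pt) y^l ⋯`, `N = n^ν` with `i, l, ν
≠ 0` mod `p`, because `Y^p ∈ ⟨N⟩` forces the exponent of `x` in `Y` to be divisible by `p`. The
parameters then change by `ν a' = l i (a i + b j)`, `ν b' = l² i b`, `ν c' = c i`, `ν d' = c t + d
l`, and every such change occurs (`params_of_extGroup_mulEquiv`, `nonempty_extGroup_mulEquiv`). For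
`c ≠ 0` the term `t` removes `d`; for `b ≠ 0` the term `j` makes `a` arbitrary. The remaining
scalings leave nine orbits, where `w` separates the square classes of `d / a` (for `b = c = 0`) and
of `c / b` (for `b, c ≠ 0`). -/

/-! ### Elements satisfying the relations of `ExtGroup` -/

/-- The elements `x, y, z, u, n` satisfy the relations of `g₁, g₂, g₃, g₄, g₅` in `ExtGroup p e`. -/
structure ExtRel (p : ℕ) (e : Fin 4 → ℕ) {X : Type*} [Group X] (x y z u n : X) : Prop where
  yx : y * x = x * y * z
  zx : z * x = x * z * n ^ e 0
  zy : z * y = y * z * n ^ e 1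
  ux : Commute u x
  uy : Commute u y
  uz : Commute u z
  nx : Commute n x
  ny : Commute n y
  nz : Commute n z
  nu : Commute n u
  xp : x ^ p = u
  yp : y ^ p = n ^ e 3
  zp : z ^ p = 1
  up : u ^ p = n ^ e 2
  np : n ^ p = 1

section

variable {X Y : Type*} [Group X] [Group Y] {p : ℕ} {e : Fin 4 → ℕ} {x y z u n : X}

theorem map_pgComm (f : X →* Y) (g h : X) : f (pgComm g h) = pgComm (f g) (f h) := by
  simp [pgComm]

theorem pgComm_eq_iff {g h k : X} : pgComm g h = k ↔ g * h = h * g * k := by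
  constructor
  · rintro rfl; simp [pgComm, mul_assoc]
  · intro hk
    rw [pgComm, mul_assoc, hk]; group

theorem pgComm_eq_one_iff {g h : X} : pgComm g h = 1 ↔ Commute g h := by
  rw [pgComm_eq_iff, mul_one]; rfl

theorem ExtRel.map (h : ExtRel p e x y z u n) (f : X →* Y) :
    ExtRel p e (f x) (f y) (f z) (f u) (f n) where
  yx := by simpa using congrArg f h.yx
  zx := by simpa using congrArg f h.zx
  zy := by simpa using congrArg f h.zy
  ux := h.ux.map f
  uy := h.uy.map f
  uz := h.uz.map f
  nx := h.nx.map f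
  ny := h.ny.map f
  nz := h.nz.map f
  nu := h.nu.map f
  xp := by simpa using congrArg f h.xp
  yp := by simpa using congrArg f h.yp
  zp := by simpa using congrArg f h.zp
  up := by simpa using congrArg f h.up
  np := by simpa using congrArg f h.np

theorem ExtRel.of_commute_of_pow (hyx : pgComm y x = z) (hzx : pgComm z x = n ^ e 0)
    (hzy : pgComm z y = n ^ e 1) (hux : pgComm u x = 1) (huy : pgComm u y = 1)
    (huz : pgComm u z = 1) (hnx : pgComm n x = 1) (hny : pgComm n y = 1) (hnz : pgComm n z = 1)
    (hnu : pgComm n u = 1) (hxp : x ^ p = u) (hyp : y ^ p = n ^ e 3) (hzp : z ^ p = 1)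
    (hup : u ^ p = n ^ e 2) (hnp : n ^ p = 1) : ExtRel p e x y z u n :=
  ⟨pgComm_eq_iff.1 hyx, pgComm_eq_iff.1 hzx, pgComm_eq_iff.1 hzy, pgComm_eq_one_iff.1 hux,
    pgComm_eq_one_iff.1 huy, pgComm_eq_one_iff.1 huz, pgComm_eq_one_iff.1 hnx,
    pgComm_eq_one_iff.1 hny, pgComm_eq_one_iff.1 hnz, pgComm_eq_one_iff.1 hnu,
    hxp, hyp, hzp, hup, hnp⟩

theorem mem_of_pow_mem_of_pow_eq_one [Fact p.Prime] {K : Subgroup X} {n : X} {m : ℕ}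
    (hn : n ^ p = 1) (hm : (m : ZMod p) ≠ 0) (h : n ^ m ∈ K) : n ∈ K := by
  set k := ((m : ZMod p)⁻¹).val
  have hk : m * k ≡ 1 [MOD p] := by
    rw [← ZMod.natCast_eq_natCast_iff]
    simp [k, hm]
  have : n ^ (m * k) = n := by
    conv_rhs => rw [← pow_one n]
    exact pow_eq_pow_iff_modEq.2 (hk.of_dvd (orderOf_dvd_of_pow_eq_one hn))
  exact this ▸ pow_mul n m k ▸ pow_mem h k

/-! ### Presentations -/

theorem pcRelators_of_pow {n : ℕ} {pow : Fin n → FreeGroup (Fin n)}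
    {com : Fin n → Fin n → FreeGroup (Fin n)} (i : Fin n) :
    (PresentedGroup.of i : PresentedGroup (pcRelators p n pow com)) ^ p =
      PresentedGroup.mk _ (pow i) := by
  have := PresentedGroup.mk_eq_one_iff.2 (Subgroup.subset_normalClosure
    (show FreeGroup.of i ^ p * (pow i)⁻¹ ∈ pcRelators p n pow com from Or.inl ⟨i, rfl⟩))
  rw [map_mul, map_pow, map_inv, mul_inv_eq_one] at this
  exact this

theorem pcRelators_of_comm {n : ℕ} {pow : Fin n → FreeGroup (Fin n)}
    {com : Fin n → Fin n → FreeGroup (Fin n)} {i j : Fin n} (hij : i < j) :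
    pgComm (PresentedGroup.of j : PresentedGroup (pcRelators p n pow com)) (PresentedGroup.of i) =
      PresentedGroup.mk _ (com j i) := by
  have := PresentedGroup.mk_eq_one_iff.2 (Subgroup.subset_normalClosure
    (show pgComm (FreeGroup.of j) (FreeGroup.of i) * (com j i)⁻¹ ∈ pcRelators p n pow com from
      Or.inr ⟨i, j, hij, rfl⟩))
  rw [map_mul, map_pgComm, map_inv, mul_inv_eq_one] at this
  exact this

theorem mk_freeGroup_of {α : Type*} {rels : Set (FreeGroup α)} (i : α) :
    PresentedGroup.mk rels (FreeGroup.of i) = PresentedGroup.of i := rfl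

theorem extGroup_rel (p : ℕ) (e : Fin 4 → ℕ) :
    ExtRel p e (PresentedGroup.of 0 : ExtGroup p e) (PresentedGroup.of 1) (PresentedGroup.of 2)
      (PresentedGroup.of 3) (PresentedGroup.of 4) := by
  apply ExtRel.of_commute_of_pow <;>
  first
  | (rw [pcRelators_of_pow]; simp [mk_freeGroup_of])
  | (rw [pcRelators_of_comm (by decide)]; simp [mk_freeGroup_of])

theorem baseGroup_rel (p : ℕ) (e : Fin 4 → ℕ) :
    ExtRel p e (PresentedGroup.of 0 : BaseGroup p) (PresentedGroup.of 1) (PresentedGroup.of 2)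
      (PresentedGroup.of 3) 1 := by
  apply ExtRel.of_commute_of_pow <;>
  first
  | (rw [pcRelators_of_pow]; simp [mk_freeGroup_of])
  | (rw [pcRelators_of_comm (by decide)]; simp [mk_freeGroup_of])
  | simp [pgComm]

/-- Von Dyck's theorem: `ExtRel` lists exactly the relators of the presentation. -/
theorem ExtRel.exists_extGroup_hom (h : ExtRel p e x y z u n) :
    ∃ f : ExtGroup p e →* X, f (PresentedGroup.of 0) = x ∧ f (PresentedGroup.of 1) = y ∧
      f (PresentedGroup.of 2) = z ∧ f (PresentedGroup.of 3) = u ∧ f (PresentedGroup.of 4) = n := by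
  refine ⟨PresentedGroup.toGroup (f := ![x, y, z, u, n]) ?_, ?_⟩
  · rintro r (⟨i, rfl⟩ | ⟨i, j, hij, rfl⟩)
    · fin_cases i <;> simp [mul_inv_eq_one]
      exacts [h.xp, h.yp, h.zp, h.up, h.np]
    · rw [map_mul, map_inv, mul_inv_eq_one, map_pgComm, pgComm_eq_iff]
      fin_cases i <;> fin_cases j <;> simp at hij ⊢
      exacts [h.yx, h.zx, h.ux, h.nx, h.zy, h.uy, h.ny, h.uz, h.nz, h.nu]
  · simp

theorem ExtRel.exists_baseGroup_hom (h : ExtRel p e x y z u 1) :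
    ∃ f : BaseGroup p →* X, f (PresentedGroup.of 0) = x ∧ f (PresentedGroup.of 1) = y ∧
      f (PresentedGroup.of 2) = z ∧ f (PresentedGroup.of 3) = u := by
  refine ⟨PresentedGroup.toGroup (f := ![x, y, z, u]) ?_, ?_⟩
  · rintro r (⟨i, rfl⟩ | ⟨i, j, hij, rfl⟩)
    · fin_cases i <;> simp [mul_inv_eq_one]
      exacts [h.xp, by simpa using h.yp, h.zp, by simpa using h.up]
    · rw [map_mul, map_inv, mul_inv_eq_one, map_pgComm, pgComm_eq_iff]
      fin_cases i <;> fin_cases j <;> simp at hij ⊢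
      exacts [h.yx, by simpa using h.zx, h.ux, by simpa using h.zy, h.uy, h.uz]
  · simp

theorem extGroup_eq_top {K : Subgroup (ExtGroup p e)} (h0 : PresentedGroup.of 0 ∈ K)
    (h1 : PresentedGroup.of 1 ∈ K) (h4 : PresentedGroup.of 4 ∈ K) : K = ⊤ := by
  have h := extGroup_rel p e
  rw [eq_top_iff, ← PresentedGroup.closure_range_of, Subgroup.closure_le]
  rintro _ ⟨i, rfl⟩
  fin_cases i
  · exact h0
  · exact h1
  · have := pgComm_eq_iff.2 h.yx
    exact this ▸ mul_mem (mul_mem (mul_mem (inv_mem h1) (inv_mem h0)) h1) h0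
  · exact h.xp ▸ pow_mem h0 p
  · exact h4

/-! ### An upper bound for the order -/

/-- On a finite set, right multiplication by a generator is injective, hence bijective, so `S` is
also stable under inverses of generators. -/
theorem subset_eq_univ_of_finite {S G : Set X} (hS : S.Finite) (h1 : 1 ∈ S)
    (hG : Subgroup.closure G = ⊤) (hmul : ∀ g ∈ G, ∀ s ∈ S, s * g ∈ S) : S = Set.univ := by
  rw [Set.eq_univ_iff_forall]
  intro a
  have ha : a ∈ Subgroup.closure G := hG ▸ Subgroup.mem_top a
  induction ha using Subgroup.closure_induction_right with
  | one => exact h1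
  | mul_right s _ g hg ih => exact hmul g hg s ih
  | mul_inv_cancel s _ g hg ih =>
    have hb : Set.BijOn (· * g) S S :=
      (hS.injOn_iff_bijOn_of_mapsTo (fun s hs => hmul g hg s hs)).1
        (mul_left_injective g).injOn
    obtain ⟨t, ht, rfl⟩ := hb.surjOn ih
    simpa using ht

theorem pow_mul_of_mul_eq {m : X} (h : z * x = x * z * m) (hm : Commute m z) (k : ℕ) :
    z ^ k * x = x * z ^ k * m ^ k := by
  have hs : SemiconjBy x (z * m) z := by rw [SemiconjBy, h, mul_assoc]
  rw [← (hs.pow_right k).eq, hm.symm.mul_pow, mul_assoc]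

/-- The power formula of class two: moving each `z` past the later factors `y` produces one `m` per
pair. -/
theorem mul_pow_of_mul_eq {m : X} (h : z * y = y * z * m) (hz : Commute m z) (hy : Commute m y)
    (k : ℕ) : (y * z) ^ k = y ^ k * z ^ k * m ^ k.choose 2 := by
  induction k with
  | zero => simp
  | succ k ih =>
    have hc : Commute (m ^ k.choose 2) (y * z) := (hy.mul_right hz).pow_left _
    rw [pow_succ, ih, mul_assoc, hc.eq, ← mul_assoc, ← mul_assoc, mul_assoc (y ^ k),
      pow_mul_of_mul_eq h hz, ← mul_assoc, ← mul_assoc, mul_assoc _ (m ^ k) z,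
      (hz.pow_left k).eq, ← mul_assoc, mul_assoc _ (m ^ k), ← pow_add, ← pow_succ, mul_assoc (y ^ _),
      ← pow_succ, Nat.choose_succ_succ' k 1, Nat.choose_one_right]

theorem ExtRel.exists_pow_y_mul_x (h : ExtRel p e x y z u n) (k : ℕ) :
    ∃ m, y ^ k * x = x * y ^ k * z ^ k * n ^ m := by
  -- Conjugation by `x` turns `y` into `y * z`, hence `y ^ k` into `(y * z) ^ k`.
  have hs : SemiconjBy x (y * z) y := by rw [SemiconjBy, h.yx, mul_assoc]
  refine ⟨e 1 * k.choose 2, ?_⟩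
  rw [← (hs.pow_right k).eq, mul_pow_of_mul_eq h.zy (h.nz.pow_left _) (h.ny.pow_left _), pow_mul]
  simp only [mul_assoc]

/-- The products `x ^ i * y ^ j * z ^ k * u ^ l * n ^ m`. -/
def normalWords (x y z u n : X) : Set X :=
  {t | ∃ i j k l m : ℕ, t = x ^ i * y ^ j * z ^ k * u ^ l * n ^ m}

theorem ExtRel.normalWords_mul_mem (h : ExtRel p e x y z u n) {s g : X}
    (hs : s ∈ normalWords x y z u n) (hg : g ∈ ({x, y, z, u, n} : Set X)) :
    s * g ∈ normalWords x y z u n := by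
  obtain ⟨i, j, k, l, m, rfl⟩ := hs
  rcases hg with rfl | rfl | rfl | rfl | rfl
  · obtain ⟨m', hm'⟩ := h.exists_pow_y_mul_x j
    refine ⟨i + 1, j, j + k, l, m' + e 0 * k + m, ?_⟩
    calc _ = g ^ i * (y ^ j * (z ^ k * g)) * u ^ l * n ^ m := by
          simp only [mul_assoc]
          rw [(h.nx.pow_left m).eq, ← mul_assoc (u ^ l) g, (h.ux.pow_left l).eq]
          simp only [mul_assoc]
      _ = g ^ i * (g * y ^ j * z ^ j * n ^ m') * z ^ k * n ^ (e 0 * k) * u ^ l * n ^ m := by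
          rw [pow_mul_of_mul_eq h.zx (h.nz.pow_left _), ← hm', pow_mul]
          simp only [mul_assoc]
      _ = _ := by
          simp only [pow_add, pow_one, mul_assoc]
          rw [← mul_assoc (n ^ m'), ((h.nz.pow_left m').pow_right k).eq, mul_assoc,
            ← mul_assoc (n ^ (e 0 * k)), ((h.nu.pow_left (e 0 * k)).pow_right l).eq, mul_assoc,
            ← mul_assoc (n ^ m'), ((h.nu.pow_left m').pow_right l).eq, mul_assoc]
  · refine ⟨i, j + 1, k, l, e 1 * k + m, ?_⟩
    calc _ = x ^ i * g ^ j * (z ^ k * g) * u ^ l * n ^ m := by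
          simp only [mul_assoc]
          rw [(h.ny.pow_left m).eq, ← mul_assoc (u ^ l) g, (h.uy.pow_left l).eq]
          simp only [mul_assoc]
      _ = _ := by
          rw [pow_mul_of_mul_eq h.zy (h.nz.pow_left _), ← pow_mul]
          simp only [pow_add, pow_one, mul_assoc]
          rw [← mul_assoc (n ^ (e 1 * k)), ((h.nu.pow_left (e 1 * k)).pow_right l).eq,
            mul_assoc]
  · refine ⟨i, j, k + 1, l, m, ?_⟩
    simp only [mul_assoc]
    rw [(h.nz.pow_left m).eq, ← mul_assoc (u ^ l), (h.uz.pow_left l).eq]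
    simp only [pow_succ, mul_assoc]
  · refine ⟨i, j, k, l + 1, m, ?_⟩
    simp only [mul_assoc]
    rw [(h.nu.pow_left m).eq]
    simp only [pow_succ, mul_assoc]
  · exact ⟨i, j, k, l, m + 1, by simp only [pow_succ, mul_assoc]⟩

theorem ExtRel.normalWords_subset (h : ExtRel p e x y z u n) (hp : 0 < p) :
    normalWords x y z u n ⊆ Set.range fun v : Fin 5 → Fin p =>
      x ^ (v 0 : ℕ) * y ^ (v 1 : ℕ) * z ^ (v 2 : ℕ) * u ^ (v 3 : ℕ) * n ^ (v 4 : ℕ) := by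
  rintro _ ⟨i, j, k, l, m, rfl⟩
  have red (i : ℕ) : x ^ i = x ^ (i % p) * u ^ (i / p) := by
    conv_lhs => rw [← Nat.mod_add_div i p, pow_add, pow_mul, h.xp]
  have redy (i : ℕ) : y ^ i = y ^ (i % p) * n ^ (e 3 * (i / p)) := by
    conv_lhs => rw [← Nat.mod_add_div i p, pow_add, pow_mul, h.yp, ← pow_mul]
  have redz (i : ℕ) : z ^ i = z ^ (i % p) := by
    conv_lhs => rw [← Nat.mod_add_div i p, pow_add, pow_mul, h.zp, one_pow, mul_one]
  have redu (i : ℕ) : u ^ i = u ^ (i % p) * n ^ (e 2 * (i / p)) := by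
    conv_lhs => rw [← Nat.mod_add_div i p, pow_add, pow_mul, h.up, ← pow_mul]
  have redn (i : ℕ) : n ^ i = n ^ (i % p) := by
    conv_lhs => rw [← Nat.mod_add_div i p, pow_add, pow_mul, h.np, one_pow, mul_one]
  have hu (i l : ℕ) : u ^ i * y ^ l = y ^ l * u ^ i := ((h.uy.pow_left i).pow_right l).eq
  have huz (i l : ℕ) : u ^ i * z ^ l = z ^ l * u ^ i := ((h.uz.pow_left i).pow_right l).eq
  have hnz (i l : ℕ) : n ^ i * z ^ l = z ^ l * n ^ i := ((h.nz.pow_left i).pow_right l).eq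
  have hnu (i l : ℕ) : n ^ i * u ^ l = u ^ l * n ^ i := ((h.nu.pow_left i).pow_right l).eq
  let f (i : ℕ) : Fin p := ⟨i % p, Nat.mod_lt _ hp⟩
  -- The carries: `x ^ p = u` sends `i / p` to the exponent of `u`, whose own carry joins that of
  -- `y` in the exponent of `n`.
  refine ⟨![f i, f j, f k, f (i / p + l), f (e 3 * (j / p) + e 2 * ((i / p + l) / p) + m)], ?_⟩
  symm
  calc _ = x ^ (i % p) * (u ^ (i / p) * y ^ j) * z ^ k * u ^ l * n ^ m := by
        rw [red i]; simp only [mul_assoc]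
    _ = x ^ (i % p) * y ^ j * (u ^ (i / p) * z ^ k) * u ^ l * n ^ m := by
        rw [hu]; simp only [mul_assoc]
    _ = x ^ (i % p) * y ^ (j % p) * (n ^ (e 3 * (j / p)) * z ^ k) * u ^ (i / p + l) * n ^ m := by
        rw [huz, redy j, pow_add]; simp only [mul_assoc]
    _ = x ^ (i % p) * y ^ (j % p) * z ^ k * (n ^ (e 3 * (j / p)) * u ^ (i / p + l)) * n ^ m := by
        rw [hnz]; simp only [mul_assoc]
    _ = _ := by
        rw [hnu, redu, redz k]
        simp only [Matrix.cons_val_zero, Matrix.cons_val_one, Matrix.cons_val, f]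
        rw [← redn, pow_add, pow_add, ← mul_assoc, ← mul_assoc, ← mul_assoc,
          mul_assoc _ (n ^ (e 2 * _)), ← pow_add n, add_comm (e 2 * _), pow_add]

theorem ExtRel.card_le (h : ExtRel p e x y z u n) (hp : 0 < p)
    (hX : Subgroup.closure {x, y, z, u, n} = ⊤) : Finite X ∧ Nat.card X ≤ p ^ 5 := by
  set F := fun v : Fin 5 → Fin p =>
      x ^ (v 0 : ℕ) * y ^ (v 1 : ℕ) * z ^ (v 2 : ℕ) * u ^ (v 3 : ℕ) * n ^ (v 4 : ℕ)
  have huniv := subset_eq_univ_of_finite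
    ((Set.finite_range F).subset (h.normalWords_subset hp)) ⟨0, 0, 0, 0, 0, by simp⟩ hX
    (fun g hg s hs => h.normalWords_mul_mem hs hg)
  have hF : Function.Surjective F := by
    intro t
    exact h.normalWords_subset hp (huniv ▸ Set.mem_univ t)
  exact ⟨Finite.of_surjective F hF, by simpa using Nat.card_le_card_of_surjective F hF⟩

theorem extGroup_card_le (p : ℕ) (e : Fin 4 → ℕ) (hp : 0 < p) :
    Finite (ExtGroup p e) ∧ Nat.card (ExtGroup p e) ≤ p ^ 5 :=
  (extGroup_rel p e).card_le hp <| extGroup_eq_top (Subgroup.subset_closure (by simp))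
    (Subgroup.subset_closure (by simp)) (Subgroup.subset_closure (by simp))

end

/-! ### A model in exponential coordinates -/

/-- The central extension of `ℤ × ℤ` by `(ZMod p) × (ZMod p)` obtained, up to rescaling the last two
coordinates, from the Baker-Campbell-Hausdorff formula of the nilpotent Lie ring of class three with
`[y, x] = z`, `[z, x] = a n`, `[z, y] = b n`. -/
@[ext] structure Cover (p : ℕ) (a b : ZMod p) where
  /-- coordinate along `x` -/
  x : ℤ
  /-- coordinate along `y` -/
  y : ℤ
  /-- coordinate along `z` -/
  z : ZMod p
  /-- coordinate along `n` -/
  n : ZMod p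

namespace Cover

variable {p : ℕ} {a b : ZMod p}

instance : Mul (Cover p a b) where
  -- The `z`- and `n`-coordinates are 2 and 12 times those of the Lie ring. This clears the
  -- Baker-Campbell-Hausdorff denominators and turns the coefficient `1/2` of the `n`-part of the
  -- bracket into `12 · 1/2 · 1/2 = 3`.
  mul s t := ⟨s.x + t.x, s.y + t.y, s.z + t.z + (s.y * t.x - s.x * t.y),
    s.n + t.n + 3 * (a * (s.z * t.x - s.x * t.z) + b * (s.z * t.y - s.y * t.z)) +
      (s.y * t.x - s.x * t.y) * (a * (t.x - s.x) + b * (t.y - s.y))⟩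

instance : One (Cover p a b) where
  one := ⟨0, 0, 0, 0⟩

instance : Inv (Cover p a b) where
  inv s := ⟨-s.x, -s.y, -s.z, -s.n⟩

theorem mul_def (s t : Cover p a b) :
    s * t = ⟨s.x + t.x, s.y + t.y, s.z + t.z + (s.y * t.x - s.x * t.y),
    s.n + t.n + 3 * (a * (s.z * t.x - s.x * t.z) + b * (s.z * t.y - s.y * t.z)) +
      (s.y * t.x - s.x * t.y) * (a * (t.x - s.x) + b * (t.y - s.y))⟩ := rfl

theorem one_def : (1 : Cover p a b) = ⟨0, 0, 0, 0⟩ := rfl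

theorem inv_def (s : Cover p a b) : s⁻¹ = ⟨-s.x, -s.y, -s.z, -s.n⟩ := rfl

instance : Group (Cover p a b) :=
  Group.ofLeftAxioms
    (fun s t r => by
      simp only [mul_def]
      ext <;> push_cast <;> ring)
    (fun s => by simp [mul_def, one_def])
    (fun s => by
      simp only [mul_def, inv_def, one_def]
      ext <;> push_cast <;> ring)

/-- In exponential coordinates a power is a scalar multiple, since an element has zero bracket with
itself. -/
theorem pow_def (s : Cover p a b) (k : ℕ) : s ^ k = ⟨k * s.x, k * s.y, k * s.z, k * s.n⟩ := by
  induction k with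
  | zero => simp [one_def]
  | succ k ih =>
    rw [pow_succ, ih, mul_def]
    ext <;> push_cast <;> ring

theorem pgComm_def (s t : Cover p a b) :
    pgComm s t = ⟨0, 0, 2 * (s.y * t.x - s.x * t.y),
      6 * (a * (s.z * t.x - s.x * t.z) + b * (s.z * t.y - s.y * t.z)) +
        6 * (s.y * t.x - s.x * t.y) * (a * (t.x + s.x) + b * (t.y + s.y))⟩ := by
  simp only [pgComm, mul_def, inv_def]
  ext <;> push_cast <;> ring

/-- The central subgroup imposing `x ^ (p ^ 2) = n ^ c` and `y ^ p = n ^ d` for `n = (0, 0, 0, 12)`. -/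
def relations (a b c d : ZMod p) : Subgroup (Cover p a b) where
  carrier := {s | ∃ r t : ℤ, s = ⟨p ^ 2 * r, p * t, 0, -12 * (c * r + d * t)⟩}
  one_mem' := ⟨0, 0, by simp [one_def]⟩
  mul_mem' := by
    rintro _ _ ⟨r, t, rfl⟩ ⟨r', t', rfl⟩
    refine ⟨r + r', t + t', ?_⟩
    simp only [mul_def]
    ext <;> push_cast [ZMod.natCast_self] <;> ring
  inv_mem' := by
    rintro _ ⟨r, t, rfl⟩
    refine ⟨-r, -t, ?_⟩
    simp only [inv_def]
    ext <;> push_cast <;> ring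

theorem mem_relations {c d : ZMod p} {s : Cover p a b} :
    s ∈ relations a b c d ↔ ∃ r t : ℤ, s = ⟨p ^ 2 * r, p * t, 0, -12 * (c * r + d * t)⟩ := Iff.rfl

instance (c d : ZMod p) : (relations a b c d).Normal := by
  refine ⟨?_⟩
  rintro _ ⟨r, t, rfl⟩ g
  refine ⟨r, t, ?_⟩
  simp only [mul_def, inv_def]
  ext <;> push_cast [ZMod.natCast_self] <;> ring

end Cover

/-- The quotient of `Cover p a b` by `Cover.relations a b c d`. -/
abbrev Model (p : ℕ) (a b c d : ZMod p) : Type := Cover p a b ⧸ Cover.relations a b c d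

namespace Model

variable {p : ℕ} {a b c d : ZMod p}

/-- The class of `(x, y, z, n)`. -/
def mk (a b c d : ZMod p) (x y : ℤ) (z n : ZMod p) : Model p a b c d :=
  QuotientGroup.mk ⟨x, y, z, n⟩

theorem exists_mk (s : Model p a b c d) : ∃ x y z n, s = mk a b c d x y z n := by
  obtain ⟨s, rfl⟩ := QuotientGroup.mk_surjective s
  exact ⟨_, _, _, _, rfl⟩

theorem mk_eq_mk {x y x' y' : ℤ} {z n z' n' : ZMod p} :
    mk a b c d x y z n = mk a b c d x' y' z' n' ↔
      ∃ r t : ℤ, x' = x + p ^ 2 * r ∧ y' = y + p * t ∧ z' = z ∧ n' = n - 12 * (c * r + d * t) := by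
  rw [mk, mk, QuotientGroup.eq, Cover.mem_relations]
  refine exists₂_congr fun r t => ?_
  rw [inv_mul_eq_iff_eq_mul, Cover.mul_def, Cover.ext_iff]
  refine and_congr Iff.rfl (and_congr Iff.rfl (and_congr ?_ ?_)) <;>
  · push_cast [ZMod.natCast_self]
    ring_nf

theorem mk_mul (x y x' y' : ℤ) (z n z' n' : ZMod p) :
    mk a b c d x y z n * mk a b c d x' y' z' n' =
      mk a b c d (x + x') (y + y') (z + z' + (y * x' - x * y'))
      (n + n' + 3 * (a * (z * x' - x * z') + b * (z * y' - y * z')) +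
      (y * x' - x * y') * (a * (x' - x) + b * (y' - y))) := rfl

theorem one_eq_mk : (1 : Model p a b c d) = mk a b c d 0 0 0 0 := rfl

theorem mk_inv (x y : ℤ) (z n : ZMod p) :
    (mk a b c d x y z n)⁻¹ = mk a b c d (-x) (-y) (-z) (-n) := rfl

theorem mk_pow (x y : ℤ) (z n : ZMod p) (k : ℕ) :
    mk a b c d x y z n ^ k = mk a b c d (k * x) (k * y) (k * z) (k * n) := by
  rw [mk, ← QuotientGroup.mk_pow, Cover.pow_def]
  rfl

theorem mk_pgComm (x y x' y' : ℤ) (z n z' n' : ZMod p) :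
    pgComm (mk a b c d x y z n) (mk a b c d x' y' z' n') =
      mk a b c d 0 0 (2 * (y * x' - x * y'))
      (6 * (a * (z * x' - x * z') + b * (z * y' - y * z')) +
        6 * (y * x' - x * y') * (a * (x' + x) + b * (y' + y))) := by
  have := Cover.pgComm_def (a := a) (b := b) ⟨x, y, z, n⟩ ⟨x', y', z', n'⟩
  exact congrArg (QuotientGroup.mk (s := Cover.relations a b c d)) this

theorem le_card [NeZero p] [Finite (Model p a b c d)] : p ^ 5 ≤ Nat.card (Model p a b c d) := by
  let f : Fin (p ^ 2) × Fin p × ZMod p × ZMod p → Model p a b c d :=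
    fun v => mk a b c d (v.1 : ℕ) (v.2.1 : ℕ) v.2.2.1 v.2.2.2
  have hf : Function.Injective f := by
    rintro ⟨i, j, k, l⟩ ⟨i', j', k', l'⟩ h
    obtain ⟨r, t, h1, h2, h3, h4⟩ := mk_eq_mk.1 h
    simp only at h1 h2 h3 h4
    have hp : (0 : ℤ) < p := by exact_mod_cast NeZero.pos p
    have hr : r = 0 := by
      have e1 : ((i : ℕ) : ℤ) < p ^ 2 := by exact_mod_cast i.2
      have e2 : ((i' : ℕ) : ℤ) < p ^ 2 := by exact_mod_cast i'.2
      have e3 : (p : ℤ) ^ 2 * r < p ^ 2 * 1 := by linarith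
      have e4 : (p : ℤ) ^ 2 * (-1) < p ^ 2 * r := by linarith
      have := lt_of_mul_lt_mul_left e3 (by positivity)
      have := lt_of_mul_lt_mul_left e4 (by positivity)
      omega
    have ht : t = 0 := by
      have e1 : ((j : ℕ) : ℤ) < p := by exact_mod_cast j.2
      have e2 : ((j' : ℕ) : ℤ) < p := by exact_mod_cast j'.2
      have e3 : (p : ℤ) * t < p * 1 := by linarith
      have e4 : (p : ℤ) * (-1) < p * t := by linarith
      have := lt_of_mul_lt_mul_left e3 (by positivity)
      have := lt_of_mul_lt_mul_left e4 (by positivity)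
      omega
    subst hr ht
    simp only [mul_zero, add_zero, Nat.cast_inj, Int.cast_zero, sub_zero] at h1 h2 h4
    rw [Fin.ext h1.symm, Fin.ext h2.symm, h3, h4]
  have := Nat.card_le_card_of_injective f hf
  simp only [Nat.card_prod, Nat.card_fin, Nat.card_zmod] at this
  linarith

/-- Elements of the model satisfying the relations of another extension. -/
theorem extRel {e : Fin 4 → ℕ} (i j t l : ℤ) (ν : ZMod p)
    (h0 : ν * e 0 = l * i * (a * i + b * j)) (h1 : ν * e 1 = l ^ 2 * i * b) (h2 : ν * e 2 = c * i)
    (h3 : ν * e 3 = c * t + d * l) :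
    ExtRel p e (mk a b c d i j 0 0) (mk a b c d (p * t) l 0 0)
      (mk a b c d 0 0 (2 * l * i) (6 * (l * i) * (a * i + b * (j + l))))
      (mk a b c d (p * i) (p * j) 0 0) (mk a b c d 0 0 0 (12 * ν)) := by
  apply ExtRel.of_commute_of_pow <;>
  simp only [mk_pgComm, mk_pow, one_eq_mk, mk_eq_mk]
  · exact ⟨0, 0, by simp; ring⟩
  · exact ⟨0, 0, by simp; linear_combination 12 * h0⟩
  · exact ⟨0, 0, by simp; linear_combination 12 * h1⟩
  iterate 7 exact ⟨0, 0, by simp⟩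
  · exact ⟨0, 0, by simp⟩
  · exact ⟨-t, -l, by ring, by ring, by simp, by push_cast; linear_combination 12 * h3⟩
  · exact ⟨0, 0, by simp⟩
  -- The `p ^ 2`-th power of `X` is `(p ^ 2 * i, p ^ 2 * j, 0, 0)`; its `y`-part contributes `d * p
  -- * j = 0`.
  · exact ⟨-i, -(p * j), by ring, by ring, by simp, by
      push_cast; linear_combination 12 * h2 - 12 * d * j * ZMod.natCast_self p⟩
  · exact ⟨0, 0, by simp⟩

theorem isUnit_twelve (hp : p.Prime) (h3 : 3 < p) : IsUnit (12 : ZMod p) := by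
  have h := (ZMod.isUnit_iff_coprime 12 p).2
    (((Nat.coprime_primes hp Nat.prime_two).2 (by omega)).pow_right 2 |>.mul_right
      ((Nat.coprime_primes hp Nat.prime_three).2 (by omega))).symm
  exact_mod_cast h

/-- `N` and `Z` provide all elements with `x = y = 0`, so the last two coordinates can be adjusted
at will. What remains is that `(i, j)` and `(p * t, l)` generate `ℤ × ℤ` modulo `p ^ 2`, which holds
as their determinant is prime to `p`. -/
theorem mk_mem_of_generators (hp : p.Prime) (h3 : 3 < p) {K : Subgroup (Model p a b c d)}
    {i j t l : ℤ} {z n z' n' n'' ν : ZMod p} (hi : (i : ZMod p) ≠ 0) (hl : (l : ZMod p) ≠ 0)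
    (hν : ν ≠ 0)
    (hX : mk a b c d i j z n ∈ K) (hY : mk a b c d (p * t) l z' n' ∈ K)
    (hZ : mk a b c d 0 0 (2 * l * i) n'' ∈ K) (hN : mk a b c d 0 0 0 (12 * ν) ∈ K) : K = ⊤ := by
  have := Fact.mk hp
  have h12 := (isUnit_twelve hp h3).ne_zero
  have h2 : (2 : ZMod p) ≠ 0 := fun h => h12 (by linear_combination 6 * h)
  have hN' (m : ZMod p) : mk a b c d 0 0 0 m ∈ K := by
    have := pow_mem hN (m / (12 * ν)).val
    rw [mk_pow] at this
    convert this using 1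
    simp
    field_simp
  have hZ' (k m : ZMod p) : mk a b c d 0 0 k m ∈ K := by
    have h := pow_mem hZ (k / (2 * l * i)).val
    rw [mk_pow] at h
    have h' := mul_mem h (hN' (m - (k / (2 * l * i)).val * n''))
    rw [mk_mul] at h'
    convert h' using 1
    simp
    field_simp
  have key {x y : ℤ} {z n : ZMod p} (h : mk a b c d x y z n ∈ K) (z' n' : ZMod p) :
      mk a b c d x y z' n' ∈ K := by
    have h' := mul_mem h (hZ' (z' - z) (n' - n + 3 * (a * x + b * y) * (z' - z)))
    rw [mk_mul] at h'
    convert h' using 1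
    simp
    ring_nf
  have hadd {x y x' y' : ℤ} (h : mk a b c d x y 0 0 ∈ K) (h' : mk a b c d x' y' 0 0 ∈ K) :
      mk a b c d (x + x') (y + y') 0 0 ∈ K := key (mul_mem h h') 0 0
  have hsmul {x y : ℤ} (k : ℤ) (h : mk a b c d x y 0 0 ∈ K) :
      mk a b c d (k * x) (k * y) 0 0 ∈ K := by
    induction k using Int.induction_on with
    | zero => simpa using hZ' 0 0
    | succ k ih => convert hadd ih h using 1; congr 1 <;> ring
    | pred k ih =>
      have := inv_mem h
      rw [mk_inv, neg_zero] at this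
      convert hadd ih this using 1; congr 1 <;> ring
  have hX' := key hX 0 0
  have hY' := key hY 0 0
  have hD : IsCoprime (i * l - p * t * j) ((p : ℤ) ^ 2) := by
    refine IsCoprime.pow_right ?_
    rw [Int.isCoprime_iff_gcd_eq_one, Int.gcd_comm, ← Int.isCoprime_iff_gcd_eq_one,
      (Nat.prime_iff_prime_int.1 hp).coprime_iff_not_dvd, ← ZMod.intCast_zmod_eq_zero_iff_dvd]
    simpa using ⟨hi, hl⟩
  -- Cramer's rule with the Bézout inverse `q` of the determinant; the error `p ^ 2 * q'` is
  -- absorbed by the relations.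
  obtain ⟨q, q', hq⟩ := hD
  have hx : mk a b c d 1 0 0 0 ∈ K := by
    have h : mk a b c d _ _ _ _ ∈ K := hadd (hsmul (q * l) hX') (hsmul (-q * j) hY')
    have h' : mk a b c d 1 0 0 (-12 * (c * q')) ∈ K := by
      convert h using 1
      rw [mk_eq_mk]
      refine ⟨-q', 0, by linear_combination hq, by ring, rfl, by push_cast; ring⟩
    exact key h' 0 0
  have hy : mk a b c d 0 1 0 0 ∈ K := by
    have h : mk a b c d _ _ _ _ ∈ K := hadd (hsmul (-q * (p * t)) hX') (hsmul (q * i) hY')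
    have h' : mk a b c d 0 1 0 (-12 * (d * (p * q'))) ∈ K := by
      convert h using 1
      rw [mk_eq_mk]
      refine ⟨0, -(p * q'), by ring, by linear_combination hq, rfl, by push_cast; ring⟩
    exact key h' 0 0
  rw [eq_top_iff]
  intro s _
  obtain ⟨x, y, z, n, rfl⟩ := exists_mk s
  have h := hadd (hsmul x hx) (hsmul y hy)
  simp only [mul_one, mul_zero, add_zero, zero_add] at h
  exact key h z n

/-- A change of generators identifies an extension with a model. -/
theorem exists_mulEquiv (hp : p.Prime) (h3 : 3 < p) {e : Fin 4 → ℕ} (i j t l : ℤ) (ν : ZMod p)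
    (hi : (i : ZMod p) ≠ 0) (hl : (l : ZMod p) ≠ 0) (hν : ν ≠ 0)
    (h0 : ν * e 0 = l * i * (a * i + b * j)) (h1 : ν * e 1 = l ^ 2 * i * b) (h2 : ν * e 2 = c * i)
    (h3' : ν * e 3 = c * t + d * l) : ∃ f : ExtGroup p e ≃* Model p a b c d,
      f (PresentedGroup.of 2) =
        mk a b c d 0 0 (2 * l * i) (6 * (l * i) * (a * i + b * (j + l))) ∧
      f (PresentedGroup.of 4) = mk a b c d 0 0 0 (12 * ν) := by
  obtain ⟨f, hf0, hf1, hf2, -, hf4⟩ := (extRel i j t l ν h0 h1 h2 h3').exists_extGroup_hom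
  have hf : Function.Surjective f := by
    rw [← MonoidHom.range_eq_top]
    exact mk_mem_of_generators hp h3 hi hl hν ⟨_, hf0⟩ ⟨_, hf1⟩ ⟨_, hf2⟩ ⟨_, hf4⟩
  obtain ⟨hfin, hle⟩ := extGroup_card_le p e hp.pos
  have : NeZero p := ⟨hp.ne_zero⟩
  have : Finite (Model p a b c d) := Finite.of_surjective f hf
  -- A surjection from a group of order at most `p ^ 5` onto one of order at least `p ^ 5` is
  -- bijective.
  exact ⟨MulEquiv.ofBijective f (hf.bijective_of_nat_card_le (hle.trans le_card)),
    hf2, hf4⟩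

end Model

open Model in
/-- The isomorphism from an extension to the model with the same parameters. -/
theorem exists_extGroup_mulEquiv_model {p : ℕ} (hp : p.Prime) (h3 : 3 < p) (e : Fin 4 → ℕ) :
    ∃ f : ExtGroup p e ≃* Model p (e 0) (e 1) (e 2) (e 3),
      f (PresentedGroup.of 2) = mk _ _ _ _ 0 0 2 (6 * ((e 0 : ZMod p) + (e 1 : ZMod p))) ∧
      f (PresentedGroup.of 4) = mk _ _ _ _ 0 0 0 12 := by
  have := Fact.mk hp
  simpa using exists_mulEquiv hp h3 (a := e 0) (b := e 1) (c := e 2) (d := e 3) (e := e)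
    1 0 0 1 1 (by simp) (by simp) one_ne_zero (by simp) (by simp) (by simp) (by simp)

theorem card_extGroup {p : ℕ} (hp : p.Prime) (h3 : 3 < p) (e : Fin 4 → ℕ) :
    Nat.card (ExtGroup p e) = p ^ 5 := by
  have := Fact.mk hp
  obtain ⟨f, -⟩ := exists_extGroup_mulEquiv_model hp h3 e
  obtain ⟨hfin, hle⟩ := extGroup_card_le p e hp.pos
  have := Finite.of_equiv _ f.toEquiv
  exact le_antisymm hle (Nat.card_congr f.toEquiv ▸ Model.le_card)

theorem nonempty_extGroup_mulEquiv {p : ℕ} (hp : p.Prime) (h3 : 3 < p) {e e' : Fin 4 → ℕ}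
    {i j t l ν : ZMod p} (hi : i ≠ 0) (hl : l ≠ 0) (hν : ν ≠ 0)
    (h0 : ν * e' 0 = l * i * (e 0 * i + e 1 * j)) (h1 : ν * e' 1 = l ^ 2 * i * e 1)
    (h2 : ν * e' 2 = e 2 * i) (h3' : ν * e' 3 = e 2 * t + e 3 * l) :
    Nonempty (ExtGroup p e ≃* ExtGroup p e') := by
  have := Fact.mk hp
  obtain ⟨f, -⟩ := exists_extGroup_mulEquiv_model hp h3 e
  obtain ⟨i, rfl⟩ := ZMod.intCast_surjective i
  obtain ⟨j, rfl⟩ := ZMod.intCast_surjective j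
  obtain ⟨t, rfl⟩ := ZMod.intCast_surjective t
  obtain ⟨l, rfl⟩ := ZMod.intCast_surjective l
  obtain ⟨g, -⟩ := Model.exists_mulEquiv hp h3 i j t l ν hi hl hν h0 h1 h2 h3'
  exact ⟨f.trans g.symm⟩

/-! ### Isomorphisms force a change of parameters. -/

namespace Model

variable {p : ℕ} {a b c d : ZMod p}

theorem mk_zero_inj (hp : p.Prime) {z n z' n' : ZMod p} :
    mk a b c d 0 0 z n = mk a b c d 0 0 z' n' ↔ z = z' ∧ n = n' := by
  refine ⟨fun h => ?_, by rintro ⟨rfl, rfl⟩; rfl⟩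
  obtain ⟨r, t, h1, h2, h3, h4⟩ := mk_eq_mk.1 h
  have hr : r = 0 := by simpa [hp.ne_zero] using h1
  have ht : t = 0 := by simpa [hp.ne_zero] using h2
  subst hr ht
  exact ⟨h3.symm, by simpa using h4.symm⟩

theorem mk_zero_pow {n : ZMod p} (k : ℕ) :
    mk a b c d 0 0 0 n ^ k = mk a b c d 0 0 0 (k * n) := by
  rw [mk_pow]; simp

/-- The central subgroup of the elements `(0, 0, 0, n)`. -/
def line (a b c d : ZMod p) : Subgroup (Model p a b c d) where
  carrier := {s | ∃ n, s = mk a b c d 0 0 0 n}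
  one_mem' := ⟨0, one_eq_mk⟩
  mul_mem' := by
    rintro _ _ ⟨n, rfl⟩ ⟨n', rfl⟩
    exact ⟨n + n', by rw [mk_mul]; simp⟩
  inv_mem' := by
    rintro _ ⟨n, rfl⟩
    exact ⟨-n, by rw [mk_inv]; simp⟩

/-- The parameters of an extension whose relations hold in the model are obtained from those of the
model by a change of generators. -/
theorem params_of_extRel (hp : p.Prime) (h3 : 3 < p) {e : Fin 4 → ℕ}
    (he : (e 0 : ZMod p) ≠ 0 ∨ (e 1 : ZMod p) ≠ 0 ∨ (e 2 : ZMod p) ≠ 0)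
    {X Y Z U N : Model p a b c d} (h : ExtRel p e X Y Z U N) (hN : N ≠ 1)
    (hZ : Z ∉ Subgroup.zpowers N) :
    ∃ i j t l ν : ZMod p, i ≠ 0 ∧ l ≠ 0 ∧ ν ≠ 0 ∧ ν * e 0 = l * i * (a * i + b * j) ∧
      ν * e 1 = l ^ 2 * i * b ∧ ν * e 2 = c * i ∧ ν * e 3 = c * t + d * l := by
  have := Fact.mk hp
  have h12 := (isUnit_twelve hp h3).ne_zero
  obtain ⟨i, j, z, n, rfl⟩ := exists_mk X
  obtain ⟨k, l, z', n', rfl⟩ := exists_mk Y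
  have hZ' := pgComm_eq_iff.2 h.yx
  rw [mk_pgComm] at hZ'
  set w : ZMod p := l * i - k * j with hw
  have hZX := pgComm_eq_iff.2 h.zx
  rw [← hZ', mk_pgComm] at hZX
  have e0 : N ^ e 0 = mk a b c d 0 0 0 (12 * (w * (a * i + b * j))) := by
    rw [← hZX]; congr 1 <;> push_cast <;> ring
  have hZY := pgComm_eq_iff.2 h.zy
  rw [← hZ', mk_pgComm] at hZY
  have e1 : N ^ e 1 = mk a b c d 0 0 0 (12 * (w * (a * k + b * l))) := by
    rw [← hZY]; congr 1 <;> push_cast <;> ring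
  have e2 : N ^ e 2 = mk a b c d 0 0 0 (12 * (c * i)) := by
    rw [← h.up, ← h.xp, mk_pow, mk_pow, mk_eq_mk]
    refine ⟨-i, -(p * j), by ring, by ring, by simp, by push_cast; simp⟩
  obtain ⟨η, hη⟩ : ∃ η, N = mk a b c d 0 0 0 η := by
    -- Some power of `N` with exponent prime to `p` lies in the line, by the three formulas above.
    have hmem : N ∈ line a b c d := by
      rcases he with he | he | he
      exacts [mem_of_pow_mem_of_pow_eq_one h.np he ⟨_, e0⟩,
        mem_of_pow_mem_of_pow_eq_one h.np he ⟨_, e1⟩, mem_of_pow_mem_of_pow_eq_one h.np he ⟨_, e2⟩]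
    exact hmem
  obtain ⟨ν, rfl⟩ : ∃ ν, η = 12 * ν := ⟨η / 12, by field_simp⟩
  have hν : ν ≠ 0 := by
    rintro rfl
    exact hN (by rw [hη, one_eq_mk, mul_zero])
  have e3 := h.yp
  rw [hη, mk_zero_pow, mk_pow, mk_eq_mk] at e3
  obtain ⟨r, t, e31, e32, -, e34⟩ := e3
  have hp0 : (p : ℤ) ≠ 0 := by exact_mod_cast hp.ne_zero
  -- Comparing first coordinates in `Y ^ p = N ^ e 3` shows that `p ^ 2` divides `p * k`.
  have hk : k = p * (-r) := mul_left_cancel₀ hp0 (by linear_combination -e31)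
  have hl : l = -t := mul_left_cancel₀ hp0 (by linear_combination -e32)
  have hk0 : (k : ZMod p) = 0 := by rw [hk]; simp
  have hwi : w = l * i := by rw [hw, hk0]; ring
  -- Otherwise `Z` would lie in the line, which is generated by `N`.
  have hw0 : w ≠ 0 := by
    intro h0
    rw [h0, mul_zero] at hZ'
    apply hZ
    rw [← hZ', hη, Subgroup.mem_zpowers_iff]
    refine ⟨((6 * (a * (z' * i - k * z) + b * (z' * j - l * z)) : ZMod p) / (12 * ν)).val, ?_⟩
    rw [zpow_natCast, mk_zero_pow, mk_zero_inj hp]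
    refine ⟨rfl, ?_⟩
    rw [ZMod.natCast_val, ZMod.cast_id, mul_zero (6 : ZMod p), zero_mul, add_zero]
    field_simp
  rw [hη, mk_zero_pow, mk_zero_inj hp] at e0 e1 e2
  have hil := hwi ▸ hw0
  refine ⟨i, j, -r, l, ν, right_ne_zero_of_mul hil, left_ne_zero_of_mul hil, hν, ?_, ?_, ?_, ?_⟩ <;>
    apply mul_left_cancel₀ h12
  · rw [← hwi]; linear_combination e0.2
  · rw [hk0, hwi] at e1; linear_combination e1.2
  · linear_combination e2.2
  · rw [hl]; push_cast at e34 ⊢; linear_combination e34 + n' * ZMod.natCast_self p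

end Model

open Model in
/-- Isomorphic extensions have parameters related by a change of generators. -/
theorem params_of_extGroup_mulEquiv {p : ℕ} (hp : p.Prime) (h3 : 3 < p) {e e' : Fin 4 → ℕ}
    (he : (e' 0 : ZMod p) ≠ 0 ∨ (e' 1 : ZMod p) ≠ 0 ∨ (e' 2 : ZMod p) ≠ 0)
    (φ : ExtGroup p e ≃* ExtGroup p e') :
    ∃ i j t l ν : ZMod p, i ≠ 0 ∧ l ≠ 0 ∧ ν ≠ 0 ∧ ν * e' 0 = l * i * (e 0 * i + e 1 * j) ∧
      ν * e' 1 = l ^ 2 * i * e 1 ∧ ν * e' 2 = e 2 * i ∧ ν * e' 3 = e 2 * t + e 3 * l := by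
  obtain ⟨f, -, -⟩ := exists_extGroup_mulEquiv_model hp h3 e
  obtain ⟨g, hg2, hg4⟩ := exists_extGroup_mulEquiv_model hp h3 e'
  have h12 := (isUnit_twelve hp h3)
  have := Fact.mk hp
  have h2 : (2 : ZMod p) ≠ 0 := fun h => h12.ne_zero (by linear_combination 6 * h)
  have hN : (PresentedGroup.of 4 : ExtGroup p e') ≠ 1 := by
    intro h
    rw [h, map_one, one_eq_mk, mk_zero_inj hp] at hg4
    exact h12.ne_zero hg4.2.symm
  have hZ : (PresentedGroup.of 2 : ExtGroup p e') ∉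
      Subgroup.zpowers (PresentedGroup.of 4 : ExtGroup p e') := by
    rintro ⟨k, hk⟩
    have h := congrArg g hk
    have hk' : ∃ m : ℕ, (mk (e' 0) (e' 1) (e' 2) (e' 3) 0 0 0 12 : Model p _ _ _ _) ^ k =
        mk _ _ _ _ 0 0 0 12 ^ m := by
      refine ⟨(k : ZMod p).val, ?_⟩
      rw [← zpow_natCast]
      refine (zpow_eq_zpow_iff_modEq.2 (Int.ModEq.of_dvd (Int.natCast_dvd_natCast.2
        (orderOf_dvd_of_pow_eq_one (n := p) ?_)) ?_))
      · rw [mk_zero_pow]; simp [one_eq_mk]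
      · rw [← ZMod.intCast_eq_intCast_iff]; simp
    obtain ⟨m, hm⟩ := hk'
    simp only [map_zpow] at h
    rw [hg2, hg4, hm, mk_zero_pow, mk_zero_inj hp] at h
    exact h2 h.1.symm
  -- The generators of `ExtGroup p e'` are transported into the model with the parameters `e`.
  let F := φ.symm.trans f
  refine params_of_extRel hp h3 he ((extGroup_rel p e').map F.toMonoidHom) ?_ ?_
  · simpa using hN
  · rintro ⟨k, hk⟩
    exact hZ ⟨k, F.injective (by simpa using hk)⟩

/-! ### The lower exponent-`p` central series -/

section

variable {p : ℕ} {G H : Type*} [Group G] [Group H]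

theorem pgComm_mul_pow_mem {i : ℕ} {h k : G} (hh : h ∈ lowerPSeries p G i)
    (hk : k ∈ lowerPSeries p G i) (g : G) : pgComm h g * k ^ p ∈ lowerPSeries p G (i + 1) :=
  Subgroup.subset_closure ⟨h, hh, k, hk, g, rfl⟩

theorem pgComm_mem_lowerPSeries {i : ℕ} {h : G} (hh : h ∈ lowerPSeries p G i) (g : G) :
    pgComm h g ∈ lowerPSeries p G (i + 1) := by
  simpa using pgComm_mul_pow_mem hh (one_mem _) g

theorem pow_mem_lowerPSeries {i : ℕ} {k : G} (hk : k ∈ lowerPSeries p G i) :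
    k ^ p ∈ lowerPSeries p G (i + 1) := by
  simpa [pgComm] using pgComm_mul_pow_mem (one_mem _) hk 1

theorem lowerPSeries_succ_le {i : ℕ} {K : Subgroup G}
    (hK : ∀ h ∈ lowerPSeries p G i, ∀ k ∈ lowerPSeries p G i, ∀ g, pgComm h g * k ^ p ∈ K) :
    lowerPSeries p G (i + 1) ≤ K := by
  rw [lowerPSeries, Subgroup.closure_le]
  rintro _ ⟨h, hh, k, hk, g, rfl⟩
  exact hK h hh k hk g

theorem lowerPSeries_antitone : Antitone (lowerPSeries p G) := by
  refine antitone_nat_of_succ_le fun i => lowerPSeries_succ_le fun h hh k hk g => ?_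
  have h1 := (lowerPSeries_normal p G i).conj_mem h hh g⁻¹
  rw [inv_inv] at h1
  have e : pgComm h g = h⁻¹ * (g⁻¹ * h * g) := by simp [pgComm, mul_assoc]
  exact mul_mem (e ▸ mul_mem (inv_mem hh) h1) (pow_mem hk p)

theorem map_lowerPSeries {f : G →* H} (hf : Function.Surjective f) (i : ℕ) :
    (lowerPSeries p G i).map f = lowerPSeries p H i := by
  induction i with
  | zero => exact Subgroup.map_top_of_surjective f hf
  | succ i ih =>
    apply le_antisymm
    · rw [Subgroup.map_le_iff_le_comap]
      refine lowerPSeries_succ_le fun h hh k hk g => ?_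
      rw [Subgroup.mem_comap, map_mul, map_pow, map_pgComm]
      exact pgComm_mul_pow_mem (ih ▸ Subgroup.mem_map_of_mem f hh)
        (ih ▸ Subgroup.mem_map_of_mem f hk) _
    · refine lowerPSeries_succ_le fun h hh k hk g => ?_
      rw [← ih] at hh hk
      obtain ⟨h, hh, rfl⟩ := hh
      obtain ⟨k, hk, rfl⟩ := hk
      obtain ⟨g, rfl⟩ := hf g
      rw [← map_pgComm, ← map_pow, ← map_mul]
      exact Subgroup.mem_map_of_mem f (pgComm_mul_pow_mem hh hk g)

theorem HasPClass.of_mulEquiv {c : ℕ} (f : G ≃* H) (h : HasPClass p G c) : HasPClass p H c := by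
  have key (i : ℕ) : lowerPSeries p H i = ⊥ ↔ lowerPSeries p G i = ⊥ := by
    rw [← map_lowerPSeries (f := f.toMonoidHom) f.surjective,
      Subgroup.map_eq_bot_iff_of_injective _ f.injective]
  exact ⟨(key c).2 h.1, fun i hi => h.2 ((key i).1 hi)⟩

/-- If `γᵢ ≤ γ_c`, then `γᵢ₊₁ ≤ γ_{c+1} = 1`, so `i ≥ c`. -/
theorem HasPClass.quotient {c : ℕ} (h : HasPClass p G (c + 1)) :
    HasPClass p (G ⧸ lowerPSeries p G c) c := by
  have key (i : ℕ) : lowerPSeries p (G ⧸ lowerPSeries p G c) i = ⊥ ↔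
      lowerPSeries p G i ≤ lowerPSeries p G c := by
    rw [← map_lowerPSeries (QuotientGroup.mk'_surjective _), Subgroup.map_eq_bot_iff,
      QuotientGroup.ker_mk']
  refine ⟨(key c).2 le_rfl, fun i hi => ?_⟩
  have hle := (key i).1 hi
  have : lowerPSeries p G (i + 1) ≤ lowerPSeries p G (c + 1) :=
    lowerPSeries_succ_le fun h hh k hk g => pgComm_mul_pow_mem (hle hh) (hle hk) g
  rw [h.1] at this
  exact Nat.le_of_succ_le_succ (h.2 (le_bot_iff.1 this))

end

/-! ### The lower exponent-`p` central series of the model. -/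

namespace Model

variable {p : ℕ} {a b c d : ZMod p}

/-- The preimage of the Frattini subgroup of `ℤ × ℤ` modulo `p`. -/
def frattini (a b c d : ZMod p) : Subgroup (Model p a b c d) where
  carrier := {s | ∃ r t z n, s = mk a b c d (p * r) (p * t) z n}
  one_mem' := ⟨0, 0, 0, 0, by simp [one_eq_mk]⟩
  mul_mem' := by
    rintro _ _ ⟨r, t, z, n, rfl⟩ ⟨r', t', z', n', rfl⟩
    rw [mk_mul]
    exact ⟨r + r', t + t', _, _, by rw [mul_add (p : ℤ), mul_add (p : ℤ)]⟩
  inv_mem' := by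
    rintro _ ⟨r, t, z, n, rfl⟩
    rw [mk_inv]
    exact ⟨-r, -t, _, _, by rw [mul_neg, mul_neg]⟩

theorem lowerPSeries_one_le : lowerPSeries p (Model p a b c d) 1 ≤ frattini a b c d := by
  refine lowerPSeries_succ_le fun h _ k _ g => ?_
  obtain ⟨x, y, z, n, rfl⟩ := exists_mk h
  obtain ⟨x', y', z', n', rfl⟩ := exists_mk k
  obtain ⟨x'', y'', z'', n'', rfl⟩ := exists_mk g
  rw [mk_pgComm, mk_pow, mk_mul]
  exact ⟨x', y', _, _, by rw [zero_add, zero_add]⟩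

/-- The parameter `d` does not occur: the `y`-coordinate of `k` is divisible by `p`, so `k ^ p`
contributes a multiple of `p * d`. Hence the second term of the series depends on `a, b, c` only and
vanishes with them. -/
theorem exists_pgComm_mul_pow_eq {h k : Model p a b c d} (hh : h ∈ frattini a b c d)
    (hk : k ∈ frattini a b c d) (g : Model p a b c d) :
    ∃ α β γ, pgComm h g * k ^ p = mk a b c d 0 0 0 (a * α + b * β + c * γ) := by
  obtain ⟨r, t, z, n, rfl⟩ := hh
  obtain ⟨r', t', z', n', rfl⟩ := hk
  obtain ⟨x, y, z'', n'', rfl⟩ := exists_mk g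
  rw [mk_pgComm, mk_pow, mk_mul]
  refine ⟨6 * z * x, 6 * z * y, 12 * r', ?_⟩
  rw [mk_eq_mk]
  refine ⟨-r', -(p * t'), by ring, by ring, ?_, ?_⟩
  · push_cast; simp
  · push_cast; simp; ring

theorem lowerPSeries_two_le : lowerPSeries p (Model p a b c d) 2 ≤ line a b c d := by
  refine lowerPSeries_succ_le fun h hh k hk g => ?_
  obtain ⟨α, β, γ, e⟩ :=
    exists_pgComm_mul_pow_eq (lowerPSeries_one_le hh) (lowerPSeries_one_le hk) g
  exact ⟨_, e⟩

theorem lowerPSeries_two_eq_bot (d : ZMod p) : lowerPSeries p (Model p 0 0 0 d) 2 = ⊥ := by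
  refine le_bot_iff.1 (lowerPSeries_succ_le fun h hh k hk g => ?_)
  obtain ⟨α, β, γ, e⟩ :=
    exists_pgComm_mul_pow_eq (lowerPSeries_one_le hh) (lowerPSeries_one_le hk) g
  simp [e, one_eq_mk]

theorem lowerPSeries_three : lowerPSeries p (Model p a b c d) 3 = ⊥ := by
  refine le_bot_iff.1 (lowerPSeries_succ_le fun h hh k hk g => ?_)
  obtain ⟨n, rfl⟩ := lowerPSeries_two_le hh
  obtain ⟨n', rfl⟩ := lowerPSeries_two_le hk
  obtain ⟨x, y, z'', n'', rfl⟩ := exists_mk g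
  rw [mk_pgComm, mk_pow, mk_mul]
  simp [one_eq_mk]

theorem card_line_le (hp : p.Prime) : Finite (line a b c d) ∧ Nat.card (line a b c d) ≤ p := by
  have := Fact.mk hp
  let f : ZMod p → line a b c d := fun n => ⟨mk a b c d 0 0 0 n, n, rfl⟩
  have hf : Function.Surjective f := by
    rintro ⟨_, n, rfl⟩
    exact ⟨n, rfl⟩
  exact ⟨Finite.of_surjective f hf, by simpa using Nat.card_le_card_of_surjective f hf⟩

end Model

/-! ### The extensions are immediate descendants -/

section

variable {p : ℕ} {e : Fin 4 → ℕ}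

/-- The commutators with `g₃` and the power `g₄ ^ p` do not all vanish. -/
def Nontriv (p : ℕ) (e : Fin 4 → ℕ) : Prop :=
  (e 0 : ZMod p) ≠ 0 ∨ (e 1 : ZMod p) ≠ 0 ∨ (e 2 : ZMod p) ≠ 0

theorem ExtRel.n_mem [Fact p.Prime] {X : Type*} [Group X] {x y z u n : X}
    (h : ExtRel p e x y z u n) (he : Nontriv p e) {K : Subgroup X} (hzx : pgComm z x ∈ K)
    (hzy : pgComm z y ∈ K) (hu : u ^ p ∈ K) : n ∈ K := by
  rcases he with he | he | he
  · exact mem_of_pow_mem_of_pow_eq_one h.np he (pgComm_eq_iff.2 h.zx ▸ hzx)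
  · exact mem_of_pow_mem_of_pow_eq_one h.np he (pgComm_eq_iff.2 h.zy ▸ hzy)
  · exact mem_of_pow_mem_of_pow_eq_one h.np he (h.up ▸ hu)

theorem of_four_mem_lowerPSeries [Fact p.Prime] (he : Nontriv p e) :
    PresentedGroup.of 4 ∈ lowerPSeries p (ExtGroup p e) 2 := by
  have h := extGroup_rel p e
  have hz : PresentedGroup.of 2 ∈ lowerPSeries p (ExtGroup p e) 1 := by
    rw [← pgComm_eq_iff.2 h.yx]
    exact pgComm_mem_lowerPSeries (i := 0) (Subgroup.mem_top _) _
  have hu : PresentedGroup.of 3 ∈ lowerPSeries p (ExtGroup p e) 1 := by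
    rw [← h.xp]
    exact pow_mem_lowerPSeries (i := 0) (Subgroup.mem_top _)
  exact h.n_mem he (pgComm_mem_lowerPSeries hz _) (pgComm_mem_lowerPSeries hz _)
    (pow_mem_lowerPSeries hu)

theorem extGroup_closure [Fact p.Prime] (he : Nontriv p e) :
    Subgroup.closure {(PresentedGroup.of 0 : ExtGroup p e), PresentedGroup.of 1} = ⊤ := by
  have h := extGroup_rel p e
  set K := Subgroup.closure {(PresentedGroup.of 0 : ExtGroup p e), PresentedGroup.of 1}
  have h0 : PresentedGroup.of 0 ∈ K := Subgroup.subset_closure (by simp)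
  have h1 : PresentedGroup.of 1 ∈ K := Subgroup.subset_closure (by simp)
  have hc {s t : ExtGroup p e} (hs : s ∈ K) (ht : t ∈ K) : pgComm s t ∈ K :=
    mul_mem (mul_mem (mul_mem (inv_mem hs) (inv_mem ht)) hs) ht
  have h2 : PresentedGroup.of 2 ∈ K := pgComm_eq_iff.2 h.yx ▸ hc h1 h0
  have h3 : PresentedGroup.of 3 ∈ K := h.xp ▸ pow_mem h0 p
  exact extGroup_eq_top h0 h1 (h.n_mem he (hc h2 h0) (hc h2 h1) (pow_mem h3 p))

variable (hp : p.Prime) (h3 : 3 < p)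
include hp h3

open Model in
theorem of_four_ne_one : (PresentedGroup.of 4 : ExtGroup p e) ≠ 1 := by
  obtain ⟨f, -, hf⟩ := exists_extGroup_mulEquiv_model hp h3 e
  have := Fact.mk hp
  intro h
  rw [h, map_one, one_eq_mk, mk_zero_inj hp] at hf
  exact (isUnit_twelve hp h3).ne_zero hf.2.symm

theorem le_card_of_of_four_mem {K : Subgroup (ExtGroup p e)} (hK : PresentedGroup.of 4 ∈ K) :
    p ≤ Nat.card K := by
  have := Fact.mk hp
  have hfin := (extGroup_card_le p e hp.pos).1
  have h : Subgroup.zpowers (PresentedGroup.of 4) ≤ K := Subgroup.zpowers_le.2 hK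
  calc p = Nat.card (Subgroup.zpowers (PresentedGroup.of 4 : ExtGroup p e)) := by
        rw [Nat.card_zpowers]
        exact (orderOf_eq_prime (extGroup_rel p e).np (of_four_ne_one hp h3)).symm
    _ ≤ _ := Subgroup.card_le_of_le h

open Model in
theorem of_two_notMem_lowerPSeries :
    (PresentedGroup.of 2 : ExtGroup p e) ∉ lowerPSeries p (ExtGroup p e) 2 := by
  obtain ⟨f, hf, -⟩ := exists_extGroup_mulEquiv_model hp h3 e
  intro h
  have h' := Subgroup.mem_map_of_mem f.toMonoidHom h
  rw [map_lowerPSeries f.surjective] at h'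
  obtain ⟨n, hn⟩ := lowerPSeries_two_le h'
  have h2 : mk _ _ _ _ _ _ _ _ = mk _ _ _ _ _ _ _ _ := hf.symm.trans hn
  rw [mk_zero_inj hp] at h2
  have := Fact.mk hp
  exact (isUnit_twelve hp h3).ne_zero (by linear_combination 6 * h2.1)

theorem hasPClass_extGroup (he : Nontriv p e) : HasPClass p (ExtGroup p e) 3 := by
  have := Fact.mk hp
  obtain ⟨f, -⟩ := exists_extGroup_mulEquiv_model hp h3 e
  constructor
  · rw [Set.mem_ofPred, ← map_lowerPSeries (f := f.symm.toMonoidHom) f.symm.surjective,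
      Model.lowerPSeries_three, Subgroup.map_bot]
  · intro i hi
    by_contra! hlt
    have h := lowerPSeries_antitone (p := p) (Nat.le_of_lt_succ hlt) (of_four_mem_lowerPSeries he)
    rw [hi, Subgroup.mem_bot] at h
    exact of_four_ne_one hp h3 h

theorem card_lowerPSeries_extGroup (he : Nontriv p e) :
    Nat.card (lowerPSeries p (ExtGroup p e) 2) = p := by
  have := Fact.mk hp
  obtain ⟨f, -⟩ := exists_extGroup_mulEquiv_model hp h3 e
  have hfin := (extGroup_card_le p e hp.pos).1
  apply le_antisymm
  · obtain ⟨hl, hle⟩ := Model.card_line_le (a := e 0) (b := e 1) (c := e 2) (d := e 3) hp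
    refine le_trans ?_ hle
    let g : lowerPSeries p (ExtGroup p e) 2 → Model.line (e 0 : ZMod p) (e 1) (e 2) (e 3) :=
      fun s => ⟨f s, Model.lowerPSeries_two_le
        (map_lowerPSeries (f := f.toMonoidHom) f.surjective 2 ▸ Subgroup.mem_map_of_mem _ s.2)⟩
    refine Nat.card_le_card_of_injective g fun s t h => ?_
    exact Subtype.ext (f.injective (congrArg Subtype.val h))
  · exact le_card_of_of_four_mem hp h3 (of_four_mem_lowerPSeries he)

theorem card_quotient_extGroup (he : Nontriv p e) :
    Nat.card (ExtGroup p e ⧸ lowerPSeries p (ExtGroup p e) 2) = p ^ 4 := by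
  have h := Subgroup.card_eq_card_quotient_mul_card_subgroup (lowerPSeries p (ExtGroup p e) 2)
  rw [card_extGroup hp h3, card_lowerPSeries_extGroup hp h3 he, pow_succ] at h
  exact (Nat.eq_of_mul_eq_mul_right hp.pos h).symm

/-- The base group is the image of the extension with zero parameters under a map that kills `n`, an
element of order `p`. -/
theorem baseGroup_card_le : Finite (BaseGroup p) ∧ Nat.card (BaseGroup p) ≤ p ^ 4 := by
  have := Fact.mk hp
  obtain ⟨f, h0, h1, h2, h4, h5⟩ := (baseGroup_rel p fun _ => 0).exists_extGroup_hom
  have hf : Function.Surjective f := by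
    rw [← MonoidHom.range_eq_top, eq_top_iff, ← PresentedGroup.closure_range_of,
      Subgroup.closure_le]
    rintro _ ⟨i, rfl⟩
    fin_cases i
    exacts [⟨_, h0⟩, ⟨_, h1⟩, ⟨_, h2⟩, ⟨_, h4⟩]
  have hfin := (extGroup_card_le p (fun _ => 0) hp.pos).1
  refine ⟨Finite.of_surjective f hf, ?_⟩
  have hcard := Subgroup.card_eq_card_quotient_mul_card_subgroup f.ker
  rw [card_extGroup hp h3, Nat.card_congr (QuotientGroup.quotientKerEquivOfSurjective f hf).toEquiv]
    at hcard
  have hker : p ≤ Nat.card f.ker :=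
     le_card_of_of_four_mem hp h3 h5
  refine Nat.le_of_mul_le_mul_right (c := p) ?_ hp.pos
  calc _ ≤ _ := Nat.mul_le_mul_left _ hker
    _ = _ := by rw [← hcard, pow_succ]

/-- Modulo the second term `n` becomes trivial, so the base group maps onto the quotient; the orders
leave no room for a kernel. -/
theorem nonempty_quotient_mulEquiv_baseGroup (he : Nontriv p e) :
    Nonempty (ExtGroup p e ⧸ lowerPSeries p (ExtGroup p e) 2 ≃* BaseGroup p) := by
  have := Fact.mk hp
  have hr := (extGroup_rel p e).map (QuotientGroup.mk' (lowerPSeries p (ExtGroup p e) 2))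
  rw [show QuotientGroup.mk' (lowerPSeries p (ExtGroup p e) 2) (PresentedGroup.of 4) = 1 from
    (QuotientGroup.eq_one_iff _).2 (of_four_mem_lowerPSeries he)] at hr
  obtain ⟨f, h0, h1, -⟩ := hr.exists_baseGroup_hom
  have hf : Function.Surjective f := by
    rw [← MonoidHom.range_eq_top, eq_top_iff,
      ← Subgroup.map_top_of_surjective _ (QuotientGroup.mk'_surjective _), ← extGroup_closure he,
      MonoidHom.map_closure, Subgroup.closure_le]
    rintro _ ⟨_, (rfl | rfl), rfl⟩
    exacts [⟨_, h0⟩, ⟨_, h1⟩]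
  obtain ⟨hfin, hle⟩ := baseGroup_card_le hp h3
  exact ⟨(MulEquiv.ofBijective f (hf.bijective_of_nat_card_le
    (by rwa [card_quotient_extGroup hp h3 he]))).symm⟩

theorem card_baseGroup : Nat.card (BaseGroup p) = p ^ 4 := by
  have := Fact.mk hp
  -- Any nontrivial parameters serve to read off the invariants of the base group.
  have he : Nontriv p fun _ => 1 := Or.inl (by simp)
  obtain ⟨f⟩ := nonempty_quotient_mulEquiv_baseGroup hp h3 he
  rw [← Nat.card_congr f.toEquiv, card_quotient_extGroup hp h3 he]

theorem hasPClass_baseGroup : HasPClass p (BaseGroup p) 2 := by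
  have := Fact.mk hp
  have he : Nontriv p fun _ => 1 := Or.inl (by simp)
  obtain ⟨f⟩ := nonempty_quotient_mulEquiv_baseGroup hp h3 he
  exact (hasPClass_extGroup hp h3 he).quotient.of_mulEquiv f

theorem isImmediateDescendant_extGroup (he : Nontriv p e) :
    IsImmediateDescendant p (ExtGroup p e) (BaseGroup p) := by
  have := Fact.mk hp
  have hE := (extGroup_card_le p e hp.pos).1
  have hB := (baseGroup_card_le hp h3).1
  obtain ⟨f⟩ := nonempty_quotient_mulEquiv_baseGroup hp h3 he
  refine ⟨hB, .of_card (card_baseGroup hp h3), hE, .of_card (card_extGroup hp h3 e), ?_,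
    2, hasPClass_baseGroup hp h3, ⟨f⟩, hasPClass_extGroup hp h3 he⟩
  let g := f.toMonoidHom.comp (QuotientGroup.mk' (lowerPSeries p (ExtGroup p e) 2))
  have hg : Function.Surjective g := f.surjective.comp (QuotientGroup.mk'_surjective _)
  have hle : Group.rank (ExtGroup p e) ≤ 2 := by
    classical
    refine (Group.rank_le (S := {PresentedGroup.of 0, PresentedGroup.of 1}) ?_).trans
      Finset.card_le_two
    simpa using extGroup_closure he
  -- A cyclic base group would be abelian, and `[g₂, g₁] = g₃` would lie in the second term of the
  -- series.
  have hge : 2 ≤ Group.rank (BaseGroup p) := by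
    obtain ⟨S, hS, hcl⟩ := Group.rank_spec (BaseGroup p)
    by_contra! hlt
    have hcomm : ∀ s t : BaseGroup p, s * t = t * s := by
      have : S.card ≤ 1 := by omega
      rw [Finset.card_le_one_iff_subset_singleton] at this
      obtain ⟨s, hs⟩ := this
      have htop : Subgroup.zpowers s = ⊤ := by
        rw [eq_top_iff, ← hcl, Subgroup.zpowers_eq_closure]
        exact Subgroup.closure_mono (by exact_mod_cast hs)
      intro a b
      obtain ⟨i, rfl⟩ := Subgroup.mem_zpowers_iff.1 (htop ▸ Subgroup.mem_top a)
      obtain ⟨j, rfl⟩ := Subgroup.mem_zpowers_iff.1 (htop ▸ Subgroup.mem_top b)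
      exact ((Commute.refl s).zpow_zpow i j).eq
    refine of_two_notMem_lowerPSeries hp h3 (e := e) ?_
    have hz : g (PresentedGroup.of 2) = 1 := by
      rw [← pgComm_eq_iff.2 (extGroup_rel p e).yx, map_pgComm, pgComm_eq_one_iff]
      exact hcomm _ _
    rw [← QuotientGroup.eq_one_iff]
    exact f.injective (hz.trans (map_one f).symm)
  exact le_antisymm (hle.trans hge) (Group.rank_le_of_surjective g hg)

end

/-! ### Immediate descendants satisfy the relations -/

section

variable {p : ℕ} {H : Type*} [Group H]

theorem mul_pow_prime_of_mul_eq (hp : p.Prime) (h3 : 3 < p) {y z m : H} (h : z * y = y * z * m)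
    (hz : Commute m z) (hy : Commute m y) (hm : m ^ p = 1) : (y * z) ^ p = y ^ p * z ^ p := by
  obtain ⟨k, hk⟩ := hp.dvd_choose_self two_ne_zero (by omega : 2 < p)
  rw [mul_pow_of_mul_eq h hz hy, hk, pow_mul, hm, one_pow, mul_one]

/-- If `n` is central, `n ^ p = 1` and the relations of the base group hold for `x, y` modulo `⟨n⟩`,
then `x, y` satisfy the relations of an extension. -/
theorem exists_extRel_of_central (hp : p.Prime) (h3 : 3 < p) {x y n : H} (hnp : n ^ p = 1)
    (hn : ∀ g, Commute n g) (hzx : pgComm (pgComm y x) x ∈ Subgroup.zpowers n)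
    (hzy : pgComm (pgComm y x) y ∈ Subgroup.zpowers n) (hup : (x ^ p) ^ p ∈ Subgroup.zpowers n)
    (hyp : y ^ p ∈ Subgroup.zpowers n) :
    ∃ e, ExtRel p e x y (pgComm y x) (x ^ p) n := by
  have hfin : IsOfFinOrder n := isOfFinOrder_iff_pow_eq_one.2 ⟨p, hp.pos, hnp⟩
  rw [← hfin.mem_powers_iff_mem_zpowers] at hzx hzy hup hyp
  obtain ⟨e0, h0⟩ := hzx
  obtain ⟨e1, h1⟩ := hzy
  obtain ⟨e2, h2⟩ := hup
  obtain ⟨e3, h3'⟩ := hyp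
  simp only at h0 h1 h2 h3'
  set z := pgComm y x with hz
  have hc (k : ℕ) (g : H) : Commute (n ^ k) g := (hn g).pow_left k
  have hcp (k : ℕ) : (n ^ k) ^ p = 1 := by rw [← pow_mul, mul_comm, pow_mul, hnp, one_pow]
  have hyx : y * x = x * y * z := pgComm_eq_iff.1 hz.symm
  have ezx : z * x = x * z * n ^ e0 := pgComm_eq_iff.1 h0.symm
  have ezy : z * y = y * z * n ^ e1 := pgComm_eq_iff.1 h1.symm
  -- `y ^ p` is central, so conjugation by `x` fixes it; but it also maps it to `(y * z) ^ p = y ^ p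
  -- * z ^ p`.
  have hzp : z ^ p = 1 := by
    have hs : SemiconjBy x (y * z) y := by rw [SemiconjBy, hyx, mul_assoc]
    have h := (hs.pow_right p).eq
    rw [mul_pow_prime_of_mul_eq hp h3 ezy (hc _ _) (hc _ _) (hcp _), ← h3'] at h
    rw [← mul_assoc, ← (hc e3 x).eq] at h
    exact mul_eq_left.1 h
  -- Conjugation by `y` sends `x` to `x * z⁻¹`, whose `p`-th power is again `x ^ p`.
  have huy : Commute (x ^ p) y := by
    have hs : SemiconjBy y (x * z⁻¹) x := by
      rw [SemiconjBy, ← mul_assoc, hyx, mul_inv_cancel_right]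
    have hzi : z⁻¹ * x = x * z⁻¹ * (n ^ e0)⁻¹ := by
      rw [inv_mul_eq_iff_eq_mul, ← mul_assoc, ← mul_assoc, ezx, mul_assoc (x * z),
        (hc e0 z⁻¹).eq, ← mul_assoc, mul_inv_cancel_right, mul_inv_cancel_right]
    have h := hs.pow_right p
    rw [mul_pow_prime_of_mul_eq hp h3 hzi (hc _ _).inv_left (hc _ _).inv_left
      (by rw [inv_pow, hcp, inv_one]), inv_pow, hzp, inv_one, mul_one] at h
    exact h.symm
  have huz : Commute (x ^ p) z := by
    have hs : SemiconjBy z x (x * n ^ e0) := by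
      rw [SemiconjBy, ezx, mul_assoc, mul_assoc, (hc e0 z).eq]
    have h := hs.pow_right p
    rw [(hc e0 x).symm.mul_pow, hcp, mul_one] at h
    exact h.symm
  exact ⟨![e0, e1, e2, e3], hyx, ezx, ezy, (Commute.refl x).pow_left p, huy, huz, hn _, hn _, hn _,
    hn _, rfl, h3'.symm, hzp, h2.symm, hnp⟩

/-- An immediate descendant of order `p ^ 5` is isomorphic to an extension. -/
theorem IsImmediateDescendant.exists_extGroup (hp : p.Prime) (h3 : 3 < p)
    (hcard : Nat.card H = p ^ 5) (hH : IsImmediateDescendant p H (BaseGroup p)) :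
    ∃ e, Nontriv p e ∧ Nonempty (H ≃* ExtGroup p e) := by
  have := Fact.mk hp
  obtain ⟨c, hc, ⟨φ⟩, hc'⟩ := hH.quotient_and_class
  obtain rfl : c = 2 := hc.unique (hasPClass_baseGroup hp h3)
  have hfin := hH.finite
  set N := lowerPSeries p H 2 with hN
  have hNcard : Nat.card N = p := by
    have h := Subgroup.card_eq_card_quotient_mul_card_subgroup N
    rw [Nat.card_congr φ.toEquiv, card_baseGroup hp h3, hcard, pow_succ] at h
    exact (Nat.eq_of_mul_eq_mul_left (pow_pos hp.pos 4) h).symm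
  have hbot : lowerPSeries p H 3 = ⊥ := hc'.1
  have hNc : ∀ h ∈ N, ∀ g, Commute h g := fun h hh g => by
    have := pgComm_mem_lowerPSeries hh g
    rwa [hbot, Subgroup.mem_bot, pgComm_eq_one_iff] at this
  have hNp : ∀ h ∈ N, h ^ p = 1 := fun h hh => by
    have := pow_mem_lowerPSeries hh
    rwa [hbot, Subgroup.mem_bot] at this
  obtain ⟨n, hn⟩ : ∃ n : H, N = Subgroup.zpowers n := by
    have := isCyclic_of_prime_card hNcard
    exact (Subgroup.isCyclic_iff_exists_zpowers_eq_top N).1 this |>.imp fun _ h => h.symm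
  have hnN : n ∈ N := hn ▸ Subgroup.mem_zpowers n
  let q : H →* BaseGroup p := φ.toMonoidHom.comp (QuotientGroup.mk' N)
  have hq : Function.Surjective q := φ.surjective.comp (QuotientGroup.mk'_surjective _)
  have hker (h : H) : q h = 1 ↔ h ∈ Subgroup.zpowers n := by
    rw [← hn, ← QuotientGroup.eq_one_iff (N := N)]
    exact φ.map_eq_one_iff
  obtain ⟨x, hx⟩ := hq (PresentedGroup.of 0)
  obtain ⟨y, hy⟩ := hq (PresentedGroup.of 1)
  have hb := baseGroup_rel p fun _ => 0
  have hqz : q (pgComm y x) = PresentedGroup.of 2 := by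
    rw [map_pgComm, hx, hy, pgComm_eq_iff.2 hb.yx]
  obtain ⟨e, he⟩ := exists_extRel_of_central hp h3 (x := x) (y := y) (hNp n hnN) (hNc n hnN)
    ((hker _).1 (by rw [map_pgComm, hqz, hx, pgComm_eq_iff.2 hb.zx, one_pow]))
    ((hker _).1 (by rw [map_pgComm, hqz, hy, pgComm_eq_iff.2 hb.zy, one_pow]))
    ((hker _).1 (by rw [map_pow, map_pow, hx, hb.xp, hb.up, one_pow]))
    ((hker _).1 (by rw [map_pow, hy, hb.yp, one_pow]))
  obtain ⟨f, hf0, hf1, hf2, hf3, hf4⟩ := he.exists_extGroup_hom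
  have hf : Function.Surjective f := by
    rw [← MonoidHom.range_eq_top]
    -- The range contains the kernel of `q` and maps onto the base group, so it is everything.
    have hle : q.ker ≤ f.range := fun h hh => by
      obtain ⟨k, rfl⟩ := (hker h).1 hh
      exact zpow_mem (show n ∈ f.range from ⟨_, hf4⟩) k
    have hmap : f.range.map q = ⊤ := by
      rw [eq_top_iff, ← PresentedGroup.closure_range_of, Subgroup.closure_le]
      rintro _ ⟨i, rfl⟩
      fin_cases i
      exacts [⟨x, ⟨_, hf0⟩, hx⟩, ⟨y, ⟨_, hf1⟩, hy⟩, ⟨_, ⟨_, hf2⟩, hqz⟩,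
        ⟨_, ⟨_, hf3⟩, by rw [map_pow, hx]; exact hb.xp⟩]
    rw [← Subgroup.comap_map_eq_self hle, hmap, Subgroup.comap_top]
  have hE := (extGroup_card_le p e hp.pos).1
  have F := MulEquiv.ofBijective f
    (hf.bijective_of_nat_card_le (by rw [card_extGroup hp h3, hcard]))
  refine ⟨e, ?_, ⟨F.symm⟩⟩
  -- With `a = b = c = 0` the second term would be trivial, yet it has order `p`.
  by_contra hne
  simp only [Nontriv, not_or, not_not] at hne
  obtain ⟨g, -⟩ := exists_extGroup_mulEquiv_model hp h3 e
  rw [hne.1, hne.2.1, hne.2.2] at g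
  have h := Model.lowerPSeries_two_eq_bot (p := p) (e 3)
  rw [← map_lowerPSeries (f := (F.symm.trans g).toMonoidHom) (F.symm.trans g).surjective,
    Subgroup.map_eq_bot_iff_of_injective _ (F.symm.trans g).injective, ← hN] at h
  rw [h, Subgroup.card_bot] at hNcard
  exact hp.ne_one hNcard.symm

end

/-! ### The list -/

section

variable {p : ℕ} [Fact p.Prime] {w : (ZMod p)ˣ}

theorem isSquare_or_isSquare_mul (hw : ∀ x : (ZMod p)ˣ, x ∈ Subgroup.zpowers w) {x : ZMod p}
    (hx : x ≠ 0) : (∃ r, r ≠ 0 ∧ r * r = x) ∨ ∃ r, r ≠ 0 ∧ r * r = x * w := by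
  obtain ⟨k, hk⟩ := hw (Units.mk0 x hx)
  have hx' : ((w ^ k : (ZMod p)ˣ) : ZMod p) = x := congrArg Units.val hk
  rcases Int.even_or_odd' k with ⟨m, rfl | rfl⟩
  · refine Or.inl ⟨(w ^ m : (ZMod p)ˣ), Units.ne_zero _, ?_⟩
    rw [← hx', ← Units.val_mul, ← zpow_add, two_mul]
  · refine Or.inr ⟨(w ^ (m + 1) : (ZMod p)ˣ), Units.ne_zero _, ?_⟩
    rw [← hx', ← Units.val_mul, ← Units.val_mul, ← zpow_add, ← zpow_add_one]
    congr 2; ring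

/-- If `w` were a square, every element would be, but odd characteristic has nonsquares. -/
theorem not_isSquare_of_generator (h3 : 3 < p) (hw : ∀ x : (ZMod p)ˣ, x ∈ Subgroup.zpowers w) :
    ¬ IsSquare (w : ZMod p) := by
  rintro ⟨r, hr⟩
  obtain ⟨a, ha⟩ := FiniteField.exists_nonsquare (F := ZMod p)
    (by rw [ZMod.ringChar_zmod_n]; omega)
  apply ha
  rcases eq_or_ne a 0 with rfl | ha0
  · exact IsSquare.zero
  rcases isSquare_or_isSquare_mul hw ha0 with ⟨s, -, hs⟩ | ⟨s, -, hs⟩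
  · exact ⟨s, hs.symm⟩
  · have hr0 : r ≠ 0 := by rintro rfl; exact w.ne_zero (by rw [hr, mul_zero])
    exact ⟨s / r, by field_simp; linear_combination -hs - a * hr⟩

theorem nontriv_listExponents (i : Fin 9) :
    Nontriv p (listExponents (w : ZMod p).val i) := by
  fin_cases i <;> simp [Nontriv, listExponents]

theorem exists_listExponents (hw : ∀ x : (ZMod p)ˣ, x ∈ Subgroup.zpowers w) {a b c : ZMod p}
    (d : ZMod p) (h : a ≠ 0 ∨ b ≠ 0 ∨ c ≠ 0) :
    ∃ (m : Fin 9) (i j t l ν : ZMod p), i ≠ 0 ∧ l ≠ 0 ∧ ν ≠ 0 ∧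
      ν * listExponents (w : ZMod p).val m 0 = l * i * (a * i + b * j) ∧
      ν * listExponents (w : ZMod p).val m 1 = l ^ 2 * i * b ∧
      ν * listExponents (w : ZMod p).val m 2 = c * i ∧
      ν * listExponents (w : ZMod p).val m 3 = c * t + d * l := by
  have hw0 := w.ne_zero
  rcases eq_or_ne c 0 with rfl | hc
  · rcases eq_or_ne b 0 with rfl | hb
    · have ha : a ≠ 0 := by simpa using h
      rcases eq_or_ne d 0 with rfl | hd
      · exact ⟨1, 1, 0, 0, 1, a, by simp [listExponents, ha]⟩
      -- With `b = c = 0` the quotient `a / d` is multiplied by `i ^ 2`, so only its square class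
      -- can be normalised.
      · rcases isSquare_or_isSquare_mul hw (div_ne_zero hd ha) with ⟨r, hr0, hr⟩ | ⟨r, hr0, hr⟩
        · refine ⟨2, r, 0, 0, 1, d, hr0, one_ne_zero, hd, ?_⟩
          field_simp at hr
          simp [listExponents]
          linear_combination -hr
        · refine ⟨3, r, 0, 0, 1, d, hr0, one_ne_zero, hd, ?_⟩
          field_simp at hr
          simp [listExponents]
          linear_combination -hr
    · rcases eq_or_ne d 0 with rfl | hd
      · refine ⟨5, 1, (b - a) / b, 0, 1, b, one_ne_zero, one_ne_zero, hb, ?_⟩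
        simp [listExponents]
        field_simp
        ring
      · refine ⟨6, 1, (d / b * b - a) / b, 0, d / b, d * (d / b), one_ne_zero, div_ne_zero hd hb,
          mul_ne_zero hd (div_ne_zero hd hb), ?_⟩
        simp [listExponents]
        refine ⟨?_, ?_⟩ <;> field_simp
        ring
  -- For `c ≠ 0` the choice `t = -d * l / c` removes the fourth parameter.
  · have ht (l : ZMod p) : c * (-d * l / c) + d * l = 0 := by field_simp; ring
    rcases eq_or_ne b 0 with rfl | hb
    · rcases eq_or_ne a 0 with rfl | ha
      · exact ⟨0, 1, 0, -d * 1 / c, 1, c, by rw [ht]; simp [listExponents, hc]⟩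
      · refine ⟨4, 1, 0, -d * (c / a) / c, c / a, c, one_ne_zero, div_ne_zero hc ha, hc, ?_⟩
        rw [ht]
        simp [listExponents, ha]
    -- Here `b / c` is multiplied by `l ^ 2`, and `j` is chosen so that the first two parameters
    -- agree.
    · rcases isSquare_or_isSquare_mul hw (div_ne_zero hc hb) with ⟨r, hr0, hr⟩ | ⟨r, hr0, hr⟩
      · refine ⟨7, 1, (r * b - a) / b, -d * r / c, r, c, one_ne_zero, hr0, hc, ?_⟩
        rw [ht]
        field_simp at hr
        simp [listExponents]
        refine ⟨?_, ?_⟩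
        · field_simp; linear_combination -hr
        · linear_combination -hr
      · refine ⟨8, 1, (r * b - a) / b, -d * r / c, r, c, one_ne_zero, hr0, hc, ?_⟩
        rw [ht]
        field_simp at hr
        simp [listExponents]
        refine ⟨?_, ?_⟩
        · field_simp; linear_combination -hr
        · linear_combination -hr

theorem listExponents_injective (hw : ¬ IsSquare (w : ZMod p)) {m m' : Fin 9}
    {i j t l ν : ZMod p} (hi : i ≠ 0) (hl : l ≠ 0) (hν : ν ≠ 0) {e e' : Fin 4 → ℕ}
    (he : e = listExponents (w : ZMod p).val m) (he' : e' = listExponents (w : ZMod p).val m')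
    (h0 : ν * e' 0 = l * i * (e 0 * i + e 1 * j)) (h1 : ν * e' 1 = l ^ 2 * i * e 1)
    (h2 : ν * e' 2 = e 2 * i) (h3 : ν * e' 3 = e 2 * t + e 3 * l) : m = m' := by
  have hw0 := w.ne_zero
  have hsq (r : ZMod p) : r * r ≠ w := fun h => hw ⟨r, h.symm⟩
  have hsq' (r : ZMod p) : r * r * w ≠ 1 := fun h => hw ⟨r * w, by linear_combination -w * h⟩
  subst he he'
  fin_cases m <;> fin_cases m' <;> simp [listExponents, hi, hl, hν] at h0 h1 h2 h3 ⊢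
  -- Which parameters vanish settles most pairs. There remain `G₃, G₄` and `G₈, G₉`, in both orders,
  -- where an isomorphism would make `w` or its inverse a square.
  all_goals try grind
  · exact hsq i (mul_left_cancel₀ hν (by rw [h0, h3]; ring))
  · exact hsq' i (mul_left_cancel₀ hν (by rw [mul_one]; nth_rw 2 [h0]; rw [h3]; ring))
  · exact hsq l (mul_left_cancel₀ hν (by rw [h1, h2]; ring))
  · exact hsq' l (mul_left_cancel₀ hν (by rw [mul_one]; nth_rw 2 [h1]; rw [h2]; ring))

end

theorem mainTheorem8 (p : ℕ) [Fact p.Prime] (hp : 3 < p)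
    (w : (ZMod p)ˣ) (hw : ∀ x : (ZMod p)ˣ, x ∈ Subgroup.zpowers w) :
    Nat.card (BaseGroup p) = p ^ 4 ∧
    (∀ i : Fin 9, Nat.card (ListGroup p w i) = p ^ 5 ∧
      IsImmediateDescendant p (ListGroup p w i) (BaseGroup p)) ∧
    (∀ i j : Fin 9, Nonempty (ListGroup p w i ≃* ListGroup p w j) → i = j) ∧
    (∀ (H : Type*) [Group H], Nat.card H = p ^ 5 →
      IsImmediateDescendant p H (BaseGroup p) →
      ∃ i : Fin 9, Nonempty (H ≃* ListGroup p w i)) := by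
  have hpr : p.Prime := Fact.out
  refine ⟨card_baseGroup hpr hp, fun i => ⟨card_extGroup hpr hp _,
    isImmediateDescendant_extGroup hpr hp (nontriv_listExponents i)⟩, ?_, ?_⟩
  · rintro m m' ⟨φ⟩
    obtain ⟨i, j, t, l, ν, hi, hl, hν, h0, h1, h2, h3⟩ :=
      params_of_extGroup_mulEquiv hpr hp (nontriv_listExponents m') φ
    exact listExponents_injective (not_isSquare_of_generator hp hw) hi hl hν rfl rfl h0 h1 h2 h3
  · intro H _ hcard hH
    obtain ⟨e, he, ⟨φ⟩⟩ := hH.exists_extGroup hpr hp hcard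
    obtain ⟨m, i, j, t, l, ν, hi, hl, hν, h0, h1, h2, h3⟩ := exists_listExponents hw (e 3) he
    obtain ⟨ψ⟩ := nonempty_extGroup_mulEquiv hpr hp hi hl hν h0 h1 h2 h3
    exact ⟨m, ⟨φ.trans ψ⟩⟩
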